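/- All Banach spaces are real. Let $X$ be a separable Banach space which contains no complemented subspace isomorphic to $\ell_1$. Suppose that for every $\delta>0$ there are a Banach space $Y$ containing $X$ isometrically and a sequence of finite-rank bounded operators $A_n:X\to Y$ ($n\ge 1$) such that $$\Big\|\sum_{j=1}^n\epsilon_jA_j\Big\|<1+\delta\qquad(\epsilon_j=\pm1,\ n=1,2,\dots)\qquad\text{and}\qquad x=\sum_{j=1}^\infty A_jx\quad(x\in X).\tag{$*$}$$ Here $d(X,W)$ denotes the Banach–Mazur distance $\inf\|T\|\,\|T^{-1}\|$ over all isomorphisms $T$ of $X$ onto $W$. A Schauder basis $(e_j)$ of $Z$ is 1-unconditional if $\|\sum_{j\le n}\epsilon_ja_je_j\|\le\|\sum_{j\le n}a_je_j\|$ for all $n$, all real $a_j$ and all signs $\epsilon_j=\pm1$. A 1-UFDD of $Z$ is a sequence $(Q_j)$ of finite-rank bounded projections on $Z$ with $Q_iQ_j=0$ for $i\ne j$ and $z=\sum_jQ_jz$ for all $z\in Z$, such that $\|\sum_{j\le n}\epsilon_jQ_jz\|\le\|\sum_{j\le n}Q_jz\|$ for all $n$, $z\in Z$ and $\epsilon_j=\pm1$.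 A basis or UFDD with partial sum projections $S_n$ is shrinking if $\|S_n^*z^*-z^*\|\to0$ for every $z^*\in Z^*$. A subspace $W$ of $Z$ is $\lambda$-complemented if there is a projection of $Z$ onto $W$ of norm at most $\lambda$. Then: (i) For every $\delta>0$ there are a Banach space $Z$ with a shrinking 1-unconditional basis and a subspace $X_\delta$ of $Z$ such that $d(X,X_\delta)<1+\delta$. (ii) If $X$ is reflexive, then $Z$ in (i) may be taken reflexive. (iii) Suppose that for every $\delta>0$ one can take $Y=X$ in $(*)$, or that $X$ has the unconditional metric approximation property (UMAP): there are finite-rank bounded operators $T_n:X\to X$ with $T_nx\to x$ for all $x\in X$ and $\|I-2T_n\|\to1$. Then for every $\delta>0$ there are a Banach space $Z$ with a shrinking 1-UFDD and a $(1+\delta)$-complemented subspace $X_\delta$ of $Z$ such that $d(X,X_\delta)<1+\delta$. (iv) If $X$ is reflexive, then $Z$ in (iii) may be taken reflexive. -/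

import Mathlib

open Filter Topology
open scoped ENNReal

universe u

section BanachSpaceNotions

variable (X : Type*) [NormedAddCommGroup X] [NormedSpace ℝ X]
variable {Y : Type*} [NormedAddCommGroup Y] [NormedSpace ℝ Y]

/-- Reflexivity: the canonical map into the bidual is onto. -/
def IsReflexiveSpace : Prop :=
  Function.Surjective (NormedSpace.inclusionInDoubleDual ℝ X)

/-- `X` contains a complemented copy of `ℓ₁`: some (closed) subspace of `X` that is the range of a
bounded projection is linearly homeomorphic to `ℓ₁`. -/
def ContainsComplementedEllOne : Prop :=
  ∃ E : Submodule ℝ X, E.ClosedComplemented ∧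
    Nonempty (E ≃L[ℝ] lp (fun _ : ℕ => ℝ) 1)

/-- The multiplicative Banach-Mazur distance `inf ‖T‖ ‖T⁻¹‖` over all linear homeomorphisms
`T : X → Y`; it is `∞` when there are none. -/
noncomputable def banachMazurDist (Y : Type*) [NormedAddCommGroup Y] [NormedSpace ℝ Y] : ℝ≥0∞ :=
  ⨅ T : X ≃L[ℝ] Y, ‖(T : X →L[ℝ] Y)‖ₑ * ‖(T.symm : Y →L[ℝ] X)‖ₑ

/-- The unconditional metric approximation property. -/
def HasUMAP : Prop :=
  ∃ T : ℕ → X →L[ℝ] X,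
    (∀ n, FiniteDimensional ℝ (T n).toLinearMap.range) ∧
    (∀ x, Tendsto (fun n => T n x) atTop (𝓝 x)) ∧
    Tendsto (fun n => ‖ContinuousLinearMap.id ℝ X - (2 : ℝ) • T n‖) atTop (𝓝 1)

variable {X}

/-- For an isometric embedding `J : X → Y`, the operators `A n : X → Y` have finite rank, all
signed partial sums `∑_{j<n} ε_j A_j` have norm less than `1 + δ`, and `J x = ∑ A_j x` for
every `x` (convergence of the partial sums in norm). -/
structure IsUnconditionalExpansion (J : X →ₗᵢ[ℝ] Y) (δ : ℝ) (A : ℕ → X →L[ℝ] Y) : Prop where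
  finiteRank : ∀ n, FiniteDimensional ℝ (A n).toLinearMap.range
  norm_signed_sum_lt : ∀ (ε : ℕ → ℝ), (∀ j, ε j = 1 ∨ ε j = -1) → ∀ n : ℕ,
    ‖∑ j ∈ Finset.range n, ε j • A j‖ < 1 + δ
  tendsto_sum : ∀ x, Tendsto (fun n => ∑ j ∈ Finset.range n, A j x) atTop (𝓝 (J x))

/-- A subspace is `c`-complemented if it is the range of a projection of norm at most `c`. -/
def Submodule.IsComplementedWith (W : Submodule ℝ X) (c : ℝ) : Prop :=
  ∃ P : X →L[ℝ] W, (∀ w : W, P w = w) ∧ ‖P‖ ≤ c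

/-- A Schauder basis is 1-unconditional if changing signs of the coefficients of a finite linear
combination of basis vectors does not increase (hence does not change) its norm. -/
def SchauderBasis.IsOneUnconditional (b : SchauderBasis ℝ X) : Prop :=
  ∀ (ε : ℕ → ℝ), (∀ j, ε j = 1 ∨ ε j = -1) → ∀ (a : ℕ → ℝ) (n : ℕ),
    ‖∑ j ∈ Finset.range n, ε j • a j • b.basis j‖ ≤ ‖∑ j ∈ Finset.range n, a j • b.basis j‖

/-- A Schauder basis with partial sum projections `S_n` is shrinking if `S_n^* f = f ∘ S_n`
converges in norm to `f` for every functional `f`, i.e. the coordinate functionals form a basis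
of the dual space. -/
def SchauderBasis.IsShrinkingBasis (b : SchauderBasis ℝ X) : Prop :=
  ∀ f : StrongDual ℝ X, Tendsto (fun n => f.comp (b.proj n)) atTop (𝓝 f)

/-- `Q` is a finite-dimensional decomposition of the space: the `Q j` are finite-rank bounded
projections that annihilate one another, and `x = ∑ Q_j x` for every `x`. -/
structure IsFDD (Q : ℕ → X →L[ℝ] X) : Prop where
  finiteRank : ∀ j, FiniteDimensional ℝ (Q j).toLinearMap.range
  idem : ∀ j, (Q j).comp (Q j) = Q j
  orth : ∀ i j, i ≠ j → (Q i).comp (Q j) = 0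
  tendsto_sum : ∀ x, Tendsto (fun n => ∑ j ∈ Finset.range n, Q j x) atTop (𝓝 x)

/-- A 1-UFDD: an FDD such that changing signs of the components of a finite sum does not increase
(hence does not change) its norm. -/
structure IsOneUFDD (Q : ℕ → X →L[ℝ] X) : Prop extends IsFDD Q where
  norm_signed_sum_le : ∀ (ε : ℕ → ℝ), (∀ j, ε j = 1 ∨ ε j = -1) → ∀ (x : X) (n : ℕ),
    ‖∑ j ∈ Finset.range n, ε j • Q j x‖ ≤ ‖∑ j ∈ Finset.range n, Q j x‖

/-- An FDD is shrinking if the adjoints of its partial sum projections converge strongly to the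
identity of the dual space. -/
def IsShrinkingFDD (Q : ℕ → X →L[ℝ] X) : Prop :=
  ∀ f : StrongDual ℝ X,
    Tendsto (fun n => f.comp (∑ j ∈ Finset.range n, Q j)) atTop (𝓝 f)

end BanachSpaceNotions

/-!
Write `V` for the space of weakly unconditionally Cauchy series `∑ g_j` in the dual of `X` whose
terms belong to prescribed finite-dimensional spaces `G j` of functionals, normed by
`sup {∑ |g_j x| : ‖x‖ ≤ 1}`, that is, as operators `X → ℓ₁` (`WUCSeries`). The space `Z` that is
sought is the predual of `V`: the closed span in `V*` of the adjoint ranges of the coordinate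
projections (`WUCSeries.Predual`).

Since `X` has no complemented copy of `ℓ₁`, its dual contains no `c₀`
(`containsComplementedEllOne_of_le_abs`, from Rosenthal's disjointification lemma). Hence all series
in `V` converge in the norm of `V`, and the decomposition of `V` into the `G j` is
1-unconditional and boundedly complete (`WUCSeries.isBoundedlyCompleteUFDD_proj`). It follows that
the dual of `Z` is `V` (`IsBoundedlyCompleteUFDD.exists_eval_eq`) and that the decomposition of `Z`
is shrinking, whatever the `G j` are. If `X` is reflexive, the decomposition of `V` is shrinking as
well, so that `Z` is all of `V*` and reflexive: `V` embeds in `C(K)` for the product `K` of a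
cube and the weakly compact unit ball of `X`, and remainders of bounded sequences of series tend to
zero pointwise on `K` (`WUCSeries.mem_dualPart_of_isReflexiveSpace`).

A point `x` of `X` acts on `V` by `∑ g_j ↦ ∑ g_j x`. This contraction `X → V*` has its values in
`Z` provided that, for `x` in a dense set, all but finitely many `G j` vanish at `x`. To achieve
this, the partial sums of the given expansion `J = ∑ A_j` are perturbed so as to agree with `J` on
larger and larger finite-dimensional subspaces of `X` (`IsFinitaryExpansion`). The unconditional
metric approximation property produces such expansions too, with `J` the identity
(`HasUMAP.exists_isFinitaryExpansion`).

If `J` is the identity, let `G j` be the range of the adjoint of `A_j`. The operator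
`f ↦ ∑ f ∘ A_j` from the dual of `X` to `V` has as its adjoint a left inverse `Z → X` of the
embedding, of norm close to one (`IsFinitaryExpansion.exists_complemented`). In general, the
functionals `f ∘ A_j` with `‖f‖ ≤ 1` are approximated by the members of a finite set for each `j`,
and the `G j` are the lines spanned by the members of all these sets. Then `Z` has a basis, and the
series that approximate `∑ f ∘ A_j` show that `X` is embedded almost isometrically
(`IsFinitaryExpansion.exists_schauderBasis`).
-/

/-! ### Rosenthal's lemma and complemented copies of the space of summable sequences -/

/-- Rosenthal's disjointification lemma for a matrix with nonnegative entries and uniformly bounded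
row sums: after passing to a subset of the indices the off-diagonal row sums are small. The bound
on the row sums is a multiple `n * ε` of the desired one, and `n` drops by one in each step. -/
theorem exists_injective_sum_offDiag_le {ε : ℝ} (hε : 0 ≤ ε) (n : ℕ) :
    ∀ b : ℕ → ℕ → ℝ, (∀ l k, 0 ≤ b l k) → (∀ l (F : Finset ℕ), ∑ k ∈ F, b l k ≤ n * ε) →
    ∃ φ : ℕ → ℕ, Function.Injective φ ∧
      ∀ l (F : Finset ℕ), l ∉ F → ∑ k ∈ F, b (φ l) (φ k) ≤ ε := by
  induction n with
  | zero =>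
    intro b _ h
    exact ⟨id, Function.injective_id, fun l F _ => (h l F).trans (by simpa using hε)⟩
  | succ n ih =>
    intro b hb h
    -- split the indices into infinitely many infinite rows `{pair p i | i}`
    by_cases hp : ∃ p : ℕ, ∀ i (F : Finset ℕ), i ∉ F →
        ∑ k ∈ F, b (Nat.pair p i) (Nat.pair p k) ≤ ε
    · obtain ⟨p, hp⟩ := hp
      exact ⟨Nat.pair p, fun i j hij => (Nat.pair_eq_pair.1 hij).2, hp⟩
    · -- every row `p` has an index `pair p (i p)` of large off-diagonal sum inside that row;
      -- restricted to these indices the sums drop by `ε`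
      push Not at hp
      choose i F hiF hF using hp
      have hinj : Function.Injective fun p => Nat.pair p (i p) :=
        fun p q hpq => (Nat.pair_eq_pair.1 hpq).1
      obtain ⟨φ, hφ, hφ'⟩ := ih (fun p q => b (Nat.pair p (i p)) (Nat.pair q (i q)))
        (fun _ _ => hb _ _) (fun p G => by
          have hdisj : Disjoint (G.image fun q => Nat.pair q (i q))
              ((F p).image fun k => Nat.pair p k) := by
            rw [Finset.disjoint_left]
            intro m hm hm'
            obtain ⟨q, _, rfl⟩ := Finset.mem_image.1 hm
            obtain ⟨k, hk, hkq⟩ := Finset.mem_image.1 hm'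
            obtain ⟨rfl, rfl⟩ := Nat.pair_eq_pair.1 hkq
            exact hiF _ hk
          have := h (Nat.pair p (i p)) ((G.image fun q => Nat.pair q (i q)) ∪
            ((F p).image fun k => Nat.pair p k))
          rw [Finset.sum_union hdisj, Finset.sum_image (fun a _ b _ hab => hinj hab),
            Finset.sum_image (fun a _ b _ hab => (Nat.pair_eq_pair.1 hab).2)] at this
          have h2 := hF p
          push_cast at this
          linarith)
      exact ⟨fun p => Nat.pair (φ p) (i (φ p)), hinj.comp hφ, hφ'⟩

section EllOne

variable {X : Type*} [NormedAddCommGroup X] [NormedSpace ℝ X]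

theorem norm_le_of_forall_sum_abs_le {a : lp (fun _ : ℕ => ℝ) 1} {C : ℝ} (hC : 0 ≤ C)
    (h : ∀ F : Finset ℕ, ∑ j ∈ F, |a j| ≤ C) : ‖a‖ ≤ C :=
  lp.norm_le_of_forall_sum_le (by simp) hC (fun F => by simpa using h F)

theorem sum_abs_le_norm (a : lp (fun _ : ℕ => ℝ) 1) (F : Finset ℕ) : ∑ j ∈ F, |a j| ≤ ‖a‖ := by
  simpa using lp.sum_rpow_le_norm_rpow (p := 1) (by simp) a F

theorem summable_abs_lp_one (a : lp (fun _ : ℕ => ℝ) 1) : Summable fun j => |a j| := by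
  simpa using (lp.hasSum_norm (p := 1) (by simp) a).summable

/-- The operator `x ↦ (g_j x)_j` into `ℓ₁` given by a weakly unconditionally Cauchy series of
functionals. -/
noncomputable def ellOneOperator (g : ℕ → StrongDual ℝ X) (C : ℝ)
    (h : ∀ (F : Finset ℕ) x, ∑ j ∈ F, |g j x| ≤ C * ‖x‖) : X →L[ℝ] lp (fun _ : ℕ => ℝ) 1 :=
  LinearMap.mkContinuous
    { toFun := fun x => ⟨fun j => g j x, memℓp_gen' (C := C * ‖x‖) (by simpa using fun F => h F x)⟩
      map_add' := fun x y => by ext j; exact map_add (g j) x y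
      map_smul' := fun c x => by ext j; exact map_smul (g j) c x } C
    (fun x => norm_le_of_forall_sum_abs_le ((by simpa using h ∅ x)) (fun F => h F x))

/-- The operator `a ↦ ∑ a_l x_l` on `ℓ₁` given by a bounded sequence of vectors. -/
noncomputable def ellOneLift [CompleteSpace X] (x : ℕ → X) (B : ℝ) (hB : ∀ l, ‖x l‖ ≤ B) :
    lp (fun _ : ℕ => ℝ) 1 →L[ℝ] X :=
  have hs : ∀ a : lp (fun _ : ℕ => ℝ) 1, Summable fun l => ‖a l • x l‖ := fun a =>
    Summable.of_nonneg_of_le (fun _ => norm_nonneg _)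
      (fun l => by rw [norm_smul]; exact mul_le_mul_of_nonneg_left (hB l) (norm_nonneg _))
      ((summable_abs_lp_one a).mul_right B)
  LinearMap.mkContinuous
    { toFun := fun a => ∑' l, a l • x l
      map_add' := fun a b => by
        rw [← (hs a).of_norm.tsum_add (hs b).of_norm]
        exact tsum_congr fun l => add_smul _ _ _
      map_smul' := fun c a => by
        simp only [RingHom.id_apply]
        rw [← (hs a).of_norm.tsum_const_smul]
        exact tsum_congr fun l => mul_smul _ _ _ } B
    (fun a => by
      have h1 : ‖a‖ = ∑' l, |a l| := by simpa using lp.norm_eq_tsum_rpow (p := 1) (by simp) a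
      rw [h1, ← tsum_mul_left]
      refine (norm_tsum_le_tsum_norm (hs a)).trans ?_
      refine (hs a).tsum_le_tsum (fun l => ?_) ((summable_abs_lp_one a).mul_left B)
      rw [norm_smul, mul_comm]
      exact mul_le_mul_of_nonneg_right (hB l) (norm_nonneg _))

theorem ellOneLift_single [CompleteSpace X] (x : ℕ → X) (B : ℝ) (hB) (l : ℕ) :
    ellOneLift x B hB (lp.single 1 l 1) = x l := by
  change ∑' k, (lp.single (E := fun _ : ℕ => ℝ) 1 l 1 : lp (fun _ : ℕ => ℝ) 1) k • x k = x l
  rw [tsum_eq_single l (fun k hk => by rw [lp.single_apply_ne _ _ _ hk, zero_smul]),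
    lp.single_apply_self, one_smul]

theorem norm_le_of_forall_norm_single_le {R : lp (fun _ : ℕ => ℝ) 1 →L[ℝ] X} {c : ℝ}
    (hc : 0 ≤ c) (h : ∀ l, ‖R (lp.single 1 l 1)‖ ≤ c) : ‖R‖ ≤ c := by
  refine R.opNorm_le_bound hc fun a => ?_
  have h1 := (lp.hasSum_single (p := 1) (by simp) a).mapL R
  have h2 : ∀ l, ‖R (lp.single 1 l (a l))‖ ≤ c * |a l| := fun l => by
    have : lp.single (E := fun _ : ℕ => ℝ) 1 l (a l) = a l • lp.single 1 l 1 := by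
      rw [← lp.single_smul]; simp
    rw [this, map_smul, norm_smul, mul_comm]
    exact mul_le_mul_of_nonneg_right (h l) (norm_nonneg _)
  have h3 : ‖a‖ = ∑' l, |a l| := by simpa using lp.norm_eq_tsum_rpow (p := 1) (by simp) a
  have h4 := ((summable_abs_lp_one a).mul_left c)
  rw [← h1.tsum_eq, h3, ← tsum_mul_left]
  exact tsum_of_norm_bounded h4.hasSum h2

/-- If the identity of `ℓ₁` factors through `X` up to an automorphism, then `X` contains a
complemented copy of `ℓ₁`. -/
theorem containsComplementedEllOne_of_isUnit (L : lp (fun _ : ℕ => ℝ) 1 →L[ℝ] X)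
    (M : X →L[ℝ] lp (fun _ : ℕ => ℝ) 1) (h : IsUnit (M.comp L)) :
    ContainsComplementedEllOne X := by
  obtain ⟨B, hB⟩ := h
  have hinv : ∀ a, (↑B⁻¹ : lp (fun _ : ℕ => ℝ) 1 →L[ℝ] lp (fun _ : ℕ => ℝ) 1) (M (L a)) = a :=
    fun a => by
      have : (↑B⁻¹ * (B : lp (fun _ : ℕ => ℝ) 1 →L[ℝ] lp (fun _ : ℕ => ℝ) 1)) a = a := by
        rw [Units.inv_mul]; rfl
      rwa [hB] at this
  refine ⟨L.toLinearMap.range, ⟨(L.comp (((↑B⁻¹ : lp (fun _ : ℕ => ℝ) 1 →L[ℝ] _)).comp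
    M)).codRestrict _ (fun x => ⟨_, rfl⟩), ?_⟩, ⟨ContinuousLinearEquiv.equivOfInverse
      (((↑B⁻¹ : lp (fun _ : ℕ => ℝ) 1 →L[ℝ] _).comp M).comp (Submodule.subtypeL _))
      (L.codRestrict _ (fun a => ⟨a, rfl⟩)) ?_ ?_⟩⟩
  · rintro ⟨_, a, rfl⟩
    ext
    exact congrArg L (hinv a)
  · rintro ⟨_, a, rfl⟩
    ext
    exact congrArg L (hinv a)
  · intro a
    exact hinv a

/-- A bounded sequence on which a weakly unconditionally Cauchy series of functionals does not
tend to zero produces a complemented copy of `ℓ₁` (Bessaga-Pełczyński). -/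
theorem containsComplementedEllOne_of_le_abs [CompleteSpace X] {ψ : ℕ → StrongDual ℝ X} {x : ℕ → X}
    {C η : ℝ} (hη : 0 < η) (hx : ∀ k, ‖x k‖ ≤ 1)
    (hψ : ∀ (F : Finset ℕ) y, ∑ k ∈ F, |ψ k y| ≤ C * ‖y‖) (h : ∀ k, η ≤ |ψ k (x k)|) :
    ContainsComplementedEllOne X := by
  obtain ⟨n, hn⟩ := exists_nat_ge (C / (η / 2))
  have hC : C ≤ n * (η / 2) := by rwa [div_le_iff₀ (by positivity)] at hn
  have hC0 : 0 ≤ C := by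
    have h1 := (hη.trans_le ((h 0).trans (by simpa using hψ {0} (x 0))))
    by_contra hneg
    nlinarith [norm_nonneg (x 0)]
  obtain ⟨φ, hφ, hoff⟩ := exists_injective_sum_offDiag_le (ε := η / 2) (by positivity) n
    (fun l k => |ψ k (x l)|) (fun _ _ => abs_nonneg _)
    (fun l F => (hψ F (x l)).trans (by nlinarith [hx l, norm_nonneg (x l)]))
  have hd : ∀ l, ψ (φ l) (x (φ l)) ≠ 0 := fun l h0 => by
    have := h (φ l); rw [h0, abs_zero] at this; linarith
  have hinv : ∀ l, |(ψ (φ l) (x (φ l)))⁻¹| ≤ η⁻¹ := fun l => by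
    rw [abs_inv]; exact inv_anti₀ hη (h _)
  let u : ℕ → X := fun l => (ψ (φ l) (x (φ l)))⁻¹ • x (φ l)
  let L := ellOneLift u η⁻¹ (fun l => by
    rw [norm_smul, Real.norm_eq_abs]
    calc _ ≤ η⁻¹ * 1 := mul_le_mul (hinv l) (hx _) (norm_nonneg _) (by positivity)
      _ = _ := mul_one _)
  let M := ellOneOperator (fun k => ψ (φ k)) C (fun F y => by
    have := hψ (F.image φ) y
    rwa [Finset.sum_image (fun a _ b _ hab => hφ hab)] at this)
  refine containsComplementedEllOne_of_isUnit L M ?_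
  have hnorm : ‖1 - M.comp L‖ ≤ 1 / 2 := by
    refine norm_le_of_forall_norm_single_le (by norm_num) fun l => ?_
    have hL : L (lp.single 1 l 1) = u l := ellOneLift_single _ _ _ _
    refine norm_le_of_forall_sum_abs_le (by norm_num) fun F => ?_
    -- the diagonal entries of `1 - M ∘ L` vanish
    have hentry : ∀ k, |((1 - M.comp L) (lp.single 1 l 1) : lp (fun _ : ℕ => ℝ) 1) k| =
        if k = l then 0 else |(ψ (φ l) (x (φ l)))⁻¹| * |ψ (φ k) (x (φ l))| := fun k => by
      have h1 : ((1 - M.comp L) (lp.single 1 l 1) : lp (fun _ : ℕ => ℝ) 1) k =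
          (lp.single 1 l (1 : ℝ) : lp (fun _ : ℕ => ℝ) 1) k - ψ (φ k) (L (lp.single 1 l 1)) := rfl
      rw [h1, hL]
      split_ifs with hk
      · subst hk
        simp [u, hd k]
      · rw [lp.single_apply_ne _ _ _ hk, zero_sub, abs_neg, map_smul, smul_eq_mul, abs_mul]
    rw [Finset.sum_congr rfl fun k _ => hentry k, Finset.sum_ite, Finset.sum_const_zero, zero_add,
      ← Finset.mul_sum]
    calc _ ≤ η⁻¹ * (η / 2) := mul_le_mul (hinv l) (hoff l _ (by simp))
            (Finset.sum_nonneg fun _ _ => abs_nonneg _) (by positivity)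
      _ = 1 / 2 := by field_simp
  have := (Units.oneSub (1 - M.comp L) (hnorm.trans_lt (by norm_num))).isUnit
  simpa using this

end EllOne

/-! ### Weakly unconditionally Cauchy series in dual spaces -/

/-- Weakly unconditionally Cauchy series in the dual of `X` have terms tending to zero in norm;
equivalently, the dual of `X` contains no copy of `c₀`. -/
def DualWUCNull (X : Type*) [NormedAddCommGroup X] [NormedSpace ℝ X] : Prop :=
  ∀ (ψ : ℕ → StrongDual ℝ X) (C : ℝ), (∀ (F : Finset ℕ) x, ∑ k ∈ F, |ψ k x| ≤ C * ‖x‖) →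
    Tendsto ψ atTop (𝓝 0)

section WUC

variable {X : Type*} [NormedAddCommGroup X] [NormedSpace ℝ X]

theorem exists_norm_le_one_lt_abs {f : StrongDual ℝ X} {η : ℝ} (hη : 0 ≤ η) (h : η < ‖f‖) :
    ∃ x, ‖x‖ ≤ 1 ∧ η < |f x| := by
  by_contra! hcon
  refine absurd h (not_lt.2 (f.opNorm_le_of_unit_norm (𝕜 := ℝ) hη fun x hx => hcon x hx.le))

theorem dualWUCNull_of_not_containsComplementedEllOne [CompleteSpace X]
    (hX : ¬ ContainsComplementedEllOne X) : DualWUCNull X := by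
  intro ψ C hψ
  by_contra hcon
  rw [Metric.tendsto_atTop] at hcon
  push Not at hcon
  obtain ⟨η, hη, hcon⟩ := hcon
  obtain ⟨φ, hφ, hφ'⟩ := Filter.extraction_of_frequently_atTop (P := fun n => η ≤ ‖ψ n‖)
    (Filter.frequently_atTop.2 fun N => by
      obtain ⟨n, hn, h⟩ := hcon N
      exact ⟨n, hn, by simpa using h⟩)
  have h2 : ∀ k, ∃ x, ‖x‖ ≤ 1 ∧ η / 2 < |ψ (φ k) x| := fun k =>
    exists_norm_le_one_lt_abs (by positivity) (by linarith [hφ' k])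
  choose x hx hx' using h2
  refine hX (containsComplementedEllOne_of_le_abs (ψ := fun k => ψ (φ k)) (x := x) (C := C)
    (half_pos hη) hx (fun F y => ?_) (fun k => (hx' k).le))
  have := hψ (F.image φ) y
  rwa [Finset.sum_image (fun a _ b _ hab => hφ.injective hab)] at this

theorem DualWUCNull.prod {Y : Type*} [NormedAddCommGroup Y] [NormedSpace ℝ Y]
    (hX : DualWUCNull X) (hY : DualWUCNull Y) : DualWUCNull (X × Y) := by
  intro ψ C hψ
  have h1 := hX (fun k => (ψ k).comp (ContinuousLinearMap.inl ℝ X Y)) C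
    (fun F x => by simpa using hψ F (x, 0))
  have h2 := hY (fun k => (ψ k).comp (ContinuousLinearMap.inr ℝ X Y)) C
    (fun F y => by simpa using hψ F (0, y))
  have h3 : ∀ k, ψ k = ((ψ k).comp (ContinuousLinearMap.inl ℝ X Y)).comp
      (ContinuousLinearMap.fst ℝ X Y) + ((ψ k).comp (ContinuousLinearMap.inr ℝ X Y)).comp
      (ContinuousLinearMap.snd ℝ X Y) := fun k => by
    ext x <;> simp [← Prod.zero_eq_mk]
  rw [show ψ = _ from funext h3]
  have e1 := ((ContinuousLinearMap.compL ℝ (X × Y) X ℝ).flip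
    (ContinuousLinearMap.fst ℝ X Y)).continuous.tendsto 0
  have e2 := ((ContinuousLinearMap.compL ℝ (X × Y) Y ℝ).flip
    (ContinuousLinearMap.snd ℝ X Y)).continuous.tendsto 0
  simpa using (e1.comp h1).add (e2.comp h2)

/-- Signs can be chosen such that the squared norm of the signed sum dominates the sum of the
squared norms. -/
theorem exists_sign_sum_sq_le {H : Type*} [NormedAddCommGroup H] [InnerProductSpace ℝ H]
    (v : ℕ → H) (n : ℕ) : ∃ ε : ℕ → ℝ, (∀ j, |ε j| ≤ 1) ∧
      ∑ j ∈ Finset.range n, ‖v j‖ ^ 2 ≤ ‖∑ j ∈ Finset.range n, ε j • v j‖ ^ 2 := by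
  induction n with
  | zero => exact ⟨0, by simp, by simp⟩
  | succ n ih =>
    obtain ⟨ε, hε, h⟩ := ih
    have key : ∀ s : ℝ, ∑ j ∈ Finset.range (n + 1), (Function.update ε n s) j • v j =
        ∑ j ∈ Finset.range n, ε j • v j + s • v n := fun s => by
      rw [Finset.sum_range_succ, Function.update_self]
      congr 1
      refine Finset.sum_congr rfl fun j hj => ?_
      rw [Function.update_of_ne (Finset.mem_range.1 hj).ne]
    have hs : ∀ s : ℝ, |s| ≤ 1 → ∀ j, |Function.update ε n s j| ≤ 1 := fun s h1 j => by
      by_cases hj : j = n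
      · subst hj; simpa
      · rw [Function.update_of_ne hj]; exact hε j
    set w := ∑ j ∈ Finset.range n, ε j • v j
    have hp := norm_add_sq_real w (v n)
    have hm := norm_sub_sq_real w (v n)
    rw [Finset.sum_range_succ]
    rcases le_total 0 (inner ℝ w (v n)) with h0 | h0
    · refine ⟨Function.update ε n 1, hs 1 (by simp), ?_⟩
      rw [key, one_smul]; linarith
    · refine ⟨Function.update ε n (-1), hs (-1) (by simp), ?_⟩
      rw [key, neg_one_smul, ← sub_eq_add_neg]; linarith

theorem dualWUCNull_of_innerProductSpace {H : Type*} [NormedAddCommGroup H]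
    [InnerProductSpace ℝ H] [CompleteSpace H] : DualWUCNull H := by
  intro ψ C hψ
  let v : ℕ → H := fun k => (InnerProductSpace.toDual ℝ H).symm (ψ k)
  have hv : ∀ k x, ψ k x = inner ℝ (v k) x := fun k x => by simp [v]
  have hvn : ∀ k, ‖v k‖ = ‖ψ k‖ := fun k => by simp [v]
  have hbound : ∀ n, ∑ j ∈ Finset.range n, ‖v j‖ ^ 2 ≤ C ^ 2 := fun n => by
    obtain ⟨ε, hε, h⟩ := exists_sign_sum_sq_le v n
    refine h.trans ?_
    set w := ∑ j ∈ Finset.range n, ε j • v j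
    have h1 : ‖w‖ ^ 2 ≤ C * ‖w‖ := by
      rw [← real_inner_self_eq_norm_sq]
      conv_lhs => rw [show inner ℝ w w = inner ℝ (∑ j ∈ Finset.range n, ε j • v j) w from rfl]
      rw [sum_inner]
      refine le_trans (Finset.sum_le_sum fun j _ => ?_) (hψ (Finset.range n) w)
      rw [hv, inner_smul_left]
      refine (le_abs_self _).trans ?_
      rw [abs_mul]
      simpa using mul_le_mul_of_nonneg_right (hε j) (abs_nonneg (inner ℝ (v j) w))
    rcases (norm_nonneg w).eq_or_lt with h0 | h0
    · rw [← h0]; simpa using sq_nonneg C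
    · have h2 : ‖w‖ ≤ C := by
        have : ‖w‖ * ‖w‖ ≤ C * ‖w‖ := by rwa [sq] at h1
        exact le_of_mul_le_mul_right this h0
      gcongr
  have hs : Summable fun j => ‖v j‖ ^ 2 :=
    summable_of_sum_range_le (fun _ => sq_nonneg _) hbound
  have h0 := hs.tendsto_atTop_zero
  rw [tendsto_zero_iff_norm_tendsto_zero]
  have h1 := (Real.continuous_sqrt.tendsto 0).comp h0
  simpa [Function.comp_def, hvn, Real.sqrt_sq] using h1

end WUC

/-! ### Finite rank operators and their adjoints -/

section FiniteRank

variable {X : Type*} [NormedAddCommGroup X] [NormedSpace ℝ X]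
variable {Y : Type*} [NormedAddCommGroup Y] [NormedSpace ℝ Y]

/-- The range `{f ∘ A | f ∈ Y*}` of the adjoint of an operator `A : X → Y`. -/
noncomputable def adjointRange (A : X →L[ℝ] Y) : Submodule ℝ (StrongDual ℝ X) :=
  ((ContinuousLinearMap.compL ℝ X Y ℝ).flip A).toLinearMap.range

theorem finiteDimensional_adjointRange (A : X →L[ℝ] Y)
    [FiniteDimensional ℝ A.toLinearMap.range] : FiniteDimensional ℝ (adjointRange A) := by
  let A' : X →L[ℝ] A.toLinearMap.range := A.codRestrict _ (fun x => ⟨x, rfl⟩)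
  let m := ((ContinuousLinearMap.compL ℝ X A.toLinearMap.range ℝ).flip A').toLinearMap
  have : FiniteDimensional ℝ m.range := inferInstance
  refine Submodule.finiteDimensional_of_le (S₂ := m.range) ?_
  rintro _ ⟨f, rfl⟩
  exact ⟨f.comp (Submodule.subtypeL _), rfl⟩

/-- A linear functional on a finite-dimensional space of functionals is an evaluation. -/
theorem exists_eval_eq_of_injective {G : Type*} [AddCommGroup G] [Module ℝ G]
    [FiniteDimensional ℝ G] (e : G →ₗ[ℝ] StrongDual ℝ X) (he : Function.Injective e)
    (l : G →ₗ[ℝ] ℝ) : ∃ x : X, ∀ g : G, l g = e g x := by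
  let B : G →ₗ[ℝ] X →ₗ[ℝ] ℝ :=
    { toFun := fun g => (e g).toLinearMap
      map_add' := fun _ _ => by simp
      map_smul' := fun _ _ => by simp }
  have hB : Function.Injective B := fun g h hgh => he <| by
    ext x
    exact LinearMap.congr_fun hgh x
  have hs : Function.Surjective B.flip := LinearMap.flip_surjective_iff₁.2 hB
  obtain ⟨x, hx⟩ := hs l
  exact ⟨x, fun g => by rw [← hx]; rfl⟩

theorem exists_eval_eq_of_finiteDimensional (G : Submodule ℝ (StrongDual ℝ X))
    [FiniteDimensional ℝ G] (l : G →ₗ[ℝ] ℝ) : ∃ x : X, ∀ g : G, l g = (g : StrongDual ℝ X) x := by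
  obtain ⟨x, hx⟩ := exists_eval_eq_of_injective (G := G) G.subtype Subtype.val_injective l
  exact ⟨x, hx⟩

end FiniteRank

/-! ### The predual of a boundedly complete unconditional decomposition -/

section Duality

variable {V : Type*} [NormedAddCommGroup V] [NormedSpace ℝ V]

/-- A finite-dimensional decomposition whose signed partial sums are contractions and which is
boundedly complete: every formal series with bounded partial sums is the expansion of a vector. -/
structure IsBoundedlyCompleteUFDD (q : ℕ → V →L[ℝ] V) : Prop extends IsFDD q where
  norm_signed_le : ∀ (ε : ℕ → ℝ), (∀ j, ε j = 1 ∨ ε j = -1) → ∀ n,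
    ‖∑ j ∈ Finset.range n, ε j • q j‖ ≤ 1
  exists_of_bounded : ∀ (g : ℕ → V) (C : ℝ), (∀ j, q j (g j) = g j) →
    (∀ n, ‖∑ j ∈ Finset.range n, g j‖ ≤ C) → ∃ v, ∀ j, q j v = g j

/-- The functionals on which the adjoints of the partial sum projections of `q` converge in norm:
the closed linear span in the dual of the ranges of the adjoints of the `q j`. -/
def dualPart (q : ℕ → V →L[ℝ] V) : Submodule ℝ (StrongDual ℝ V) where
  carrier := {z | Tendsto (fun n => z.comp (∑ j ∈ Finset.range n, q j)) atTop (𝓝 z)}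
  add_mem' := fun {a b} ha hb => by
    simpa only [Set.mem_ofPred_eq, ContinuousLinearMap.add_comp] using Tendsto.add ha hb
  zero_mem' := by simp
  smul_mem' := fun c a ha => by
    simpa only [Set.mem_ofPred_eq, ContinuousLinearMap.smul_comp] using Tendsto.const_smul ha c

theorem mem_dualPart {q : ℕ → V →L[ℝ] V} {z : StrongDual ℝ V} : z ∈ dualPart q ↔
    Tendsto (fun n => z.comp (∑ j ∈ Finset.range n, q j)) atTop (𝓝 z) := Iff.rfl

variable {q : ℕ → V →L[ℝ] V} (hq : IsBoundedlyCompleteUFDD q)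

theorem IsFDD.comp_sum (h : IsFDD q) (i n : ℕ) :
    (q i).comp (∑ j ∈ Finset.range n, q j) = if i < n then q i else 0 := by
  have : ∀ j, (q i).comp (q j) = if i = j then q i else 0 := fun j => by
    split_ifs with hij
    · subst hij; exact h.idem i
    · exact h.orth i j hij
  ext x
  have h2 : ∀ j, q i (q j x) = if i = j then q i x else 0 := fun j => by
    have := DFunLike.congr_fun (this j) x
    split_ifs with hij <;> simpa [hij] using this
  simp only [ContinuousLinearMap.comp_apply, _root_.sum_apply, map_sum, h2]
  simp only [Finset.sum_ite_eq, Finset.mem_range]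
  split_ifs <;> rfl

theorem IsFDD.apply_apply (h : IsFDD q) (i j : ℕ) (x : V) :
    q i (q j x) = if i = j then q i x else 0 := by
  split_ifs with hij
  · subst hij; exact DFunLike.congr_fun (h.idem i) x
  · exact DFunLike.congr_fun (h.orth i j hij) x

include hq in
theorem IsBoundedlyCompleteUFDD.norm_sum_le (n : ℕ) : ‖∑ j ∈ Finset.range n, q j‖ ≤ 1 := by
  simpa using hq.norm_signed_le (fun _ => 1) (fun _ => Or.inl rfl) n

theorem IsFDD.comp_comp_sum (h : IsFDD q) (z : StrongDual ℝ V) (i n : ℕ) :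
    (z.comp (q i)).comp (∑ j ∈ Finset.range n, q j) = if i < n then z.comp (q i) else 0 := by
  rw [ContinuousLinearMap.comp_assoc, h.comp_sum]
  split_ifs <;> simp

include hq in
theorem IsBoundedlyCompleteUFDD.isClosed_dualPart :
    IsClosed (dualPart q : Set (StrongDual ℝ V)) := by
  refine isClosed_of_closure_subset fun z hz => ?_
  rw [SetLike.mem_coe, mem_dualPart, Metric.tendsto_atTop]
  intro η hη
  obtain ⟨w, hw, hzw⟩ := Metric.mem_closure_iff.1 hz (η / 3) (by positivity)
  obtain ⟨N, hN⟩ := Metric.tendsto_atTop.1 (mem_dualPart.1 hw) (η / 3) (by positivity)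
  refine ⟨N, fun n hn => ?_⟩
  have h1 := hN n hn
  rw [dist_eq_norm] at h1 hzw ⊢
  have h2 : ‖(z - w).comp (∑ j ∈ Finset.range n, q j)‖ ≤ ‖z - w‖ := by
    refine (ContinuousLinearMap.opNorm_comp_le _ _).trans ?_
    exact mul_le_of_le_one_right (norm_nonneg _) (hq.norm_sum_le n)
  have h3 : z.comp (∑ j ∈ Finset.range n, q j) - z = (z - w).comp (∑ j ∈ Finset.range n, q j) +
      (w.comp (∑ j ∈ Finset.range n, q j) - w) + (w - z) := by
    rw [ContinuousLinearMap.sub_comp]; abel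
  rw [h3]
  refine (norm_add₃_le).trans_lt ?_
  rw [norm_sub_rev w z]
  linarith

theorem IsFDD.comp_mem_dualPart (h : IsFDD q) (z : StrongDual ℝ V) (i : ℕ) :
    z.comp (q i) ∈ dualPart q := by
  rw [mem_dualPart]
  refine tendsto_const_nhds.congr' ?_
  filter_upwards [eventually_gt_atTop i] with n hn
  rw [h.comp_comp_sum, if_pos hn]

/-- The Banach space `dualPart q`. -/
def DualPart (q : ℕ → V →L[ℝ] V) : Type _ := dualPart q

namespace DualPart

/-- The functional underlying an element of `DualPart q`. -/
def val (z : DualPart q) : StrongDual ℝ V := Subtype.val z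

/-- A member of the subspace `dualPart q`, viewed in `DualPart q`. -/
def mk (z : StrongDual ℝ V) (hz : z ∈ dualPart q) : DualPart q := Subtype.mk z hz

theorem val_mk (z : StrongDual ℝ V) (hz : z ∈ dualPart q) : (mk z hz).val = z := rfl

noncomputable instance : NormedAddCommGroup (DualPart q) :=
  Submodule.normedAddCommGroup (dualPart q)

noncomputable instance : NormedSpace ℝ (DualPart q) := Submodule.normedSpace (dualPart q)

@[ext]
theorem ext {z w : DualPart q} (h : z.val = w.val) : z = w := Subtype.ext h

theorem norm_val (z : DualPart q) : ‖z.val‖ = ‖z‖ := rfl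

variable (q) in
/-- The isometric embedding of `DualPart q` into the dual of `V`. -/
def valL : DualPart q →ₗᵢ[ℝ] StrongDual ℝ V where
  toFun := val
  map_add' _ _ := rfl
  map_smul' _ _ := rfl
  norm_map' _ := rfl

theorem valL_apply (z : DualPart q) : valL q z = z.val := rfl

end DualPart

include hq in
theorem IsBoundedlyCompleteUFDD.completeSpace_dualPart : CompleteSpace (DualPart q) :=
  hq.isClosed_dualPart.completeSpace_coe

/-- The restriction of the adjoint of `q j` to `dualPart q`. -/
noncomputable def dualProj (hq : IsFDD q) (j : ℕ) : DualPart q →L[ℝ] DualPart q :=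
  LinearMap.mkContinuous
    { toFun := fun z => DualPart.mk (z.val.comp (q j)) (hq.comp_mem_dualPart _ j)
      map_add' := fun _ _ => rfl
      map_smul' := fun _ _ => rfl } ‖q j‖
    (fun z => by
      rw [mul_comm]
      exact ContinuousLinearMap.opNorm_comp_le z.val (q j))

theorem coe_dualProj (h : IsFDD q) (j : ℕ) (z : DualPart q) :
    (dualProj h j z).val = z.val.comp (q j) := rfl

theorem coe_sum_smul_dualProj (h : IsFDD q) (ε : ℕ → ℝ) (n : ℕ) (z : DualPart q) :
    (∑ j ∈ Finset.range n, ε j • dualProj h j z).val =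
      z.val.comp (∑ j ∈ Finset.range n, ε j • q j) := by
  ext v
  simp only [← DualPart.valL_apply, map_sum, map_smul]
  simp [DualPart.valL_apply, coe_dualProj, _root_.sum_apply]

theorem coe_sum_dualProj (h : IsFDD q) (n : ℕ) (z : DualPart q) :
    (∑ j ∈ Finset.range n, dualProj h j z).val =
      z.val.comp (∑ j ∈ Finset.range n, q j) := by
  simpa using coe_sum_smul_dualProj h (fun _ => 1) n z

include hq in
theorem IsBoundedlyCompleteUFDD.isOneUFDD_dualProj : IsOneUFDD (dualProj hq.toIsFDD) where
  finiteRank j := by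
    have := hq.finiteRank j
    have := finiteDimensional_adjointRange (q j)
    refine FiniteDimensional.of_injective (V₂ := adjointRange (q j))
      (((DualPart.valL q).toLinearMap.comp (Submodule.subtype _)).codRestrict _ ?_) ?_
    · rintro ⟨_, z, rfl⟩
      exact ⟨z.val, rfl⟩
    · intro a b hab
      have h := congrArg Subtype.val hab
      exact Subtype.ext ((DualPart.valL q).injective h)
  idem j := by
    ext z v
    exact congrArg z.val (DFunLike.congr_fun (hq.idem j) v)
  orth i j hij := by
    ext z v
    have h := congrArg z.val (DFunLike.congr_fun (hq.orth j i hij.symm) v)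
    exact h.trans (map_zero _)
  tendsto_sum z := by
    rw [(DualPart.valL q).isometry.isEmbedding.isInducing.tendsto_nhds_iff]
    simp only [Function.comp_def, DualPart.valL_apply, coe_sum_dualProj]
    exact z.2
  norm_signed_sum_le ε hε z n := by
    have key : ∑ j ∈ Finset.range n, ε j • q j =
        (∑ j ∈ Finset.range n, q j).comp (∑ j ∈ Finset.range n, ε j • q j) := by
      ext v
      simp only [_root_.sum_apply, ContinuousLinearMap.comp_apply, map_sum,
        _root_.smul_apply, map_smul, hq.apply_apply]
      refine Finset.sum_congr rfl fun i hi => ?_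
      rw [Finset.sum_eq_single i (fun j _ hj => by rw [if_neg hj]) (fun h => absurd hi h),
        if_pos rfl]
    rw [← DualPart.norm_val, ← DualPart.norm_val, coe_sum_smul_dualProj, coe_sum_dualProj, key,
      ← ContinuousLinearMap.comp_assoc]
    refine (ContinuousLinearMap.opNorm_comp_le _ _).trans ?_
    exact mul_le_of_le_one_right (norm_nonneg _) (hq.norm_signed_le ε hε n)

include hq in
/-- Bounded completeness identifies the dual of `dualPart q` with `V`. -/
theorem IsBoundedlyCompleteUFDD.exists_eval_eq (f : StrongDual ℝ (DualPart q)) :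
    ∃ v : V, ∀ z : DualPart q, f z = z.val v := by
  -- on the adjoint range of each `q j` the functional `f` is the evaluation at some vector
  have h1 : ∀ j, ∃ v : V, ∀ z : DualPart q, f (dualProj hq.toIsFDD j z) =
      z.val (q j v) := fun j => by
    have := hq.finiteRank j
    have := finiteDimensional_adjointRange (q j)
    have hle : adjointRange (q j) ≤ dualPart q := by
      rintro _ ⟨z, rfl⟩
      exact hq.toIsFDD.comp_mem_dualPart z j
    obtain ⟨v, hv⟩ := exists_eval_eq_of_finiteDimensional (adjointRange (q j))
      (f.toLinearMap.comp (Submodule.inclusion hle))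
    exact ⟨v, fun z => hv ⟨z.val.comp (q j), ⟨z.val, rfl⟩⟩⟩
  choose g hg using h1
  have h2 : ∀ n (z : DualPart q), z.val (∑ j ∈ Finset.range n, q j (g j)) =
      f (∑ j ∈ Finset.range n, dualProj hq.toIsFDD j z) := fun n z => by
    simp [hg]
  obtain ⟨v, hv⟩ := hq.exists_of_bounded (fun j => q j (g j)) ‖f‖
    (fun j => DFunLike.congr_fun (hq.idem j) (g j)) (fun n => by
      refine NormedSpace.norm_le_dual_bound ℝ _ (norm_nonneg _) fun z => ?_
      -- replace `z` by its image under the partial sum projection, which lies in `dualPart q`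
      have hz : z.comp (∑ j ∈ Finset.range n, q j) ∈ dualPart q := by
        have : z.comp (∑ j ∈ Finset.range n, q j) = ∑ j ∈ Finset.range n, z.comp (q j) := by
          ext v; simp [_root_.sum_apply]
        rw [this]
        exact Submodule.sum_mem _ fun j _ => hq.toIsFDD.comp_mem_dualPart z j
      have e1 : z (∑ j ∈ Finset.range n, q j (g j)) =
          (z.comp (∑ j ∈ Finset.range n, q j)) (∑ j ∈ Finset.range n, q j (g j)) := by
        simp only [ContinuousLinearMap.comp_apply, _root_.sum_apply, map_sum, hq.apply_apply]
        refine Finset.sum_congr rfl fun i hi => ?_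
        rw [Finset.sum_eq_single i (fun j _ hj => by rw [if_neg hj]; simp) (fun h => absurd hi h),
          if_pos rfl]
      have e2 := h2 n (.mk _ hz)
      have e3 : (∑ j ∈ Finset.range n, dualProj hq.toIsFDD j
          (DualPart.mk _ hz)) = (DualPart.mk _ hz) := by
        ext v
        rw [coe_sum_dualProj, DualPart.val_mk]
        simp only [ContinuousLinearMap.comp_apply, _root_.sum_apply, map_sum, hq.apply_apply]
        refine Finset.sum_congr rfl fun i hi => ?_
        rw [Finset.sum_eq_single i (fun j _ hj => by rw [if_neg hj]; simp) (fun h => absurd hi h),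
          if_pos rfl]
      rw [e3] at e2
      rw [e1]
      refine (congrArg norm e2).le.trans ((f.le_opNorm _).trans ?_)
      refine mul_le_mul_of_nonneg_left ?_ (norm_nonneg _)
      refine (ContinuousLinearMap.opNorm_comp_le _ _).trans ?_
      exact mul_le_of_le_one_right (norm_nonneg _) (hq.norm_sum_le n))
  refine ⟨v, fun z => ?_⟩
  have t1 : Tendsto (fun n => f (∑ j ∈ Finset.range n, dualProj hq.toIsFDD j z)) atTop
      (𝓝 (f z)) := (f.continuous.tendsto z).comp (hq.isOneUFDD_dualProj.tendsto_sum z)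
  have t2 : Tendsto (fun n => z.val (∑ j ∈ Finset.range n, q j (g j))) atTop
      (𝓝 (z.val v)) := by
    simp only [← hv]
    exact (z.val.continuous.tendsto v).comp (hq.tendsto_sum v)
  simp only [h2] at t2
  exact tendsto_nhds_unique t1 t2

include hq in
theorem IsBoundedlyCompleteUFDD.isShrinkingFDD_dualProj :
    IsShrinkingFDD (dualProj hq.toIsFDD) := by
  intro f
  obtain ⟨v, hv⟩ := hq.exists_eval_eq f
  rw [tendsto_iff_norm_sub_tendsto_zero]
  have h := tendsto_iff_norm_sub_tendsto_zero.1 (hq.tendsto_sum v)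
  refine squeeze_zero (fun _ => norm_nonneg _) (fun n => ?_) h
  refine ContinuousLinearMap.opNorm_le_bound _ (norm_nonneg _) fun z => ?_
  have e : (f.comp (∑ j ∈ Finset.range n, dualProj hq.toIsFDD j) - f) z =
      z.val (∑ j ∈ Finset.range n, q j v - v) := by
    rw [_root_.sub_apply, ContinuousLinearMap.comp_apply, hv, hv, map_sub,
      _root_.sum_apply, coe_sum_dualProj]
    simp [_root_.sum_apply]
  rw [e, mul_comm]
  exact z.val.le_opNorm _

include hq in
theorem IsBoundedlyCompleteUFDD.isReflexiveSpace_dualPart (h : ∀ z, z ∈ dualPart q) :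
    IsReflexiveSpace (DualPart q) := by
  intro φ
  -- `ev v` is the evaluation at `v`, viewed as a functional on `dualPart q`
  let ev : V →L[ℝ] StrongDual ℝ (DualPart q) :=
    ((ContinuousLinearMap.compL ℝ (DualPart q) (StrongDual ℝ V) ℝ).flip
      (DualPart.valL q).toContinuousLinearMap).comp (NormedSpace.inclusionInDoubleDual ℝ V)
  refine ⟨.mk (φ.comp ev) (h _), ?_⟩
  ext f
  obtain ⟨v, hv⟩ := hq.exists_eval_eq f
  have hf : f = ev v := by
    ext z
    exact hv z
  rw [NormedSpace.dual_def, hv, hf]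
  rfl

end Duality

/-! ### Weak convergence of bounded sequences of continuous functions -/

/-- Dominated convergence for positive functionals on `C(K)`. -/
theorem tendsto_zero_of_positive {K : Type*} [TopologicalSpace K] [CompactSpace K] [T2Space K]
    (Λ : C(K, ℝ) →ₗ[ℝ] ℝ) (hΛ : ∀ g : C(K, ℝ), (∀ k, 0 ≤ g k) → 0 ≤ Λ g) {f : ℕ → C(K, ℝ)} {C : ℝ}
    (hC : ∀ n k, |f n k| ≤ C) (hf : ∀ k, Tendsto (fun n => f n k) atTop (𝓝 0)) :
    Tendsto (fun n => Λ (f n)) atTop (𝓝 0) := by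
  let _ : MeasurableSpace K := borel K
  have : BorelSpace K := ⟨rfl⟩
  let toC : CompactlySupportedContinuousMap K ℝ →ₗ[ℝ] C(K, ℝ) :=
    { toFun := fun g => g.toContinuousMap
      map_add' := fun _ _ => rfl
      map_smul' := fun _ _ => rfl }
  let Λ' : CompactlySupportedContinuousMap K ℝ →ₚ[ℝ] ℝ :=
    PositiveLinearMap.mk₀ (Λ.comp toC) (fun g hg => hΛ _ hg)
  let F : C(K, ℝ) → CompactlySupportedContinuousMap K ℝ := fun g =>
    ⟨g, HasCompactSupport.of_compactSpace _⟩
  have h1 : ∀ g, ∫ k, g k ∂(RealRMK.rieszMeasure Λ') = Λ g := fun g =>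
    RealRMK.integral_rieszMeasure Λ' (F g)
  have hfin : MeasureTheory.IsFiniteMeasure (RealRMK.rieszMeasure Λ') := inferInstance
  simp only [← h1]
  have := MeasureTheory.tendsto_integral_of_dominated_convergence (μ := RealRMK.rieszMeasure Λ')
    (F := fun n k => f n k) (f := fun _ => (0 : ℝ)) (fun _ => C)
    (fun n => (f n).continuous.aestronglyMeasurable)
    (MeasureTheory.integrable_const C) (fun n => Eventually.of_forall (hC n))
    (Eventually.of_forall hf)
  simpa using this

/-- If a normed space `V` is represented by continuous functions on a compact space `K` in such a
way that norms are suprema, then bounded sequences in `V` that tend to zero pointwise on `K` are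
weakly null. -/
theorem tendsto_zero_of_pointwise {K : Type*} [TopologicalSpace K] [CompactSpace K] [T2Space K]
    [Nonempty K]
    {V : Type*} [NormedAddCommGroup V] [NormedSpace ℝ V] (h : V →ₗ[ℝ] C(K, ℝ))
    (hle : ∀ v k, |h v k| ≤ ‖v‖) (hlt : ∀ v a, a < ‖v‖ → ∃ k, a < h v k) (φ : StrongDual ℝ V)
    {v : ℕ → V} {C : ℝ} (hC : ∀ n, ‖v n‖ ≤ C) (hv : ∀ k, Tendsto (fun n => h (v n) k) atTop (𝓝 0)) :
    Tendsto (fun n => φ (v n)) atTop (𝓝 0) := by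
  have hinj : Function.Injective h := by
    rw [injective_iff_map_eq_zero]
    intro v hv
    by_contra hne
    obtain ⟨k, hk⟩ := hlt v 0 (norm_pos_iff.2 hne)
    simp [hv] at hk
  have hbdd : ∀ g : C(K, ℝ), BddAbove (Set.range g) := fun g =>
    (isCompact_range g.continuous).bddAbove
  let e := LinearEquiv.ofInjective h hinj
  obtain ⟨Λ, hΛ, hΛ'⟩ := exists_extension_of_le_sublinear
    (E := C(K, ℝ)) ⟨LinearMap.range h, φ.toLinearMap.comp e.symm.toLinearMap⟩
    (fun g => ‖φ‖ * ⨆ k, g k)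
    (fun c hc g => by
      simp only [ContinuousMap.smul_apply, smul_eq_mul]
      rw [← Real.mul_iSup_of_nonneg hc.le]; ring)
    (fun g g' => by
      rw [← mul_add]
      refine mul_le_mul_of_nonneg_left (ciSup_le fun k => ?_) (norm_nonneg _)
      exact add_le_add (le_ciSup (hbdd g) k) (le_ciSup (hbdd g') k))
    (by
      rintro ⟨_, v, rfl⟩
      have h1 : e.symm ⟨h v, v, rfl⟩ = v := e.symm_apply_apply v
      have h2 : ‖v‖ ≤ ⨆ k, h v k := le_of_forall_lt fun a ha => by
        obtain ⟨k, hk⟩ := hlt v a ha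
        exact hk.trans_le (le_ciSup (hbdd (h v)) k)
      change φ (e.symm ⟨h v, v, rfl⟩) ≤ ‖φ‖ * ⨆ k, h v k
      rw [h1]
      exact (le_abs_self _).trans ((φ.le_opNorm v).trans
        (mul_le_mul_of_nonneg_left h2 (norm_nonneg _))))
  have hφ : ∀ v, Λ (h v) = φ v := fun v => by
    have h1 : e.symm ⟨h v, v, rfl⟩ = v := e.symm_apply_apply v
    rw [hΛ ⟨h v, v, rfl⟩]
    exact congrArg φ h1
  have hpos : ∀ g : C(K, ℝ), (∀ k, 0 ≤ g k) → 0 ≤ Λ g := fun g hg => by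
    have h1 := hΛ' (-g)
    have h2 : ⨆ k, (-g) k ≤ 0 := ciSup_le fun k => by simpa using hg k
    rw [map_neg] at h1
    nlinarith [norm_nonneg φ]
  simp only [← hφ]
  exact tendsto_zero_of_positive Λ hpos (fun n k => (hle _ k).trans (hC n)) hv

theorem summable_mul_of_sum_abs_le {e a : ℕ → ℝ} {c : ℝ} (he : ∀ j, |e j| ≤ 1)
    (ha : ∀ F : Finset ℕ, ∑ j ∈ F, |a j| ≤ c) : Summable fun j => e j * a j := by
  have h1 : Summable fun j => |a j| := summable_of_sum_le (fun _ => abs_nonneg _) ha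
  refine Summable.of_norm_bounded h1 fun j => ?_
  rw [Real.norm_eq_abs, abs_mul]
  exact mul_le_of_le_one_left (abs_nonneg _) (he j)

theorem abs_tsum_mul_le {e a : ℕ → ℝ} {c : ℝ} (he : ∀ j, |e j| ≤ 1)
    (ha : ∀ F : Finset ℕ, ∑ j ∈ F, |a j| ≤ c) : |∑' j, e j * a j| ≤ c := by
  have h1 : Summable fun j => |a j| := summable_of_sum_le (fun _ => abs_nonneg _) ha
  rw [← Real.norm_eq_abs]
  refine (tsum_of_norm_bounded h1.hasSum fun j => ?_).trans (h1.tsum_le_of_sum_le ha)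
  rw [Real.norm_eq_abs, abs_mul]
  exact mul_le_of_le_one_left (abs_nonneg _) (he j)

theorem WeakDual.mem_preimage_closedBall_iff {E : Type*} [SeminormedAddCommGroup E]
    [NormedSpace ℝ E] {ξ : WeakDual ℝ E} :
    ξ ∈ WeakDual.toStrongDual ⁻¹' Metric.closedBall (0 : StrongDual ℝ E) 1 ↔
      ‖WeakDual.toStrongDual ξ‖ ≤ 1 :=
  mem_closedBall_zero_iff

/-! ### The space of weakly unconditionally Cauchy series -/

section WUCSeries

variable {X : Type*} [NormedAddCommGroup X] [NormedSpace ℝ X]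

/-- The operators `v : X → ℓ₁` whose `j`-th coordinate functional belongs to `G j`. -/
def wucSubmodule (G : ℕ → Submodule ℝ (StrongDual ℝ X)) :
    Submodule ℝ (X →L[ℝ] lp (fun _ : ℕ => ℝ) 1) where
  carrier := {v | ∀ j, (lp.evalCLM ℝ (fun _ : ℕ => ℝ) 1 j).comp v ∈ G j}
  add_mem' := fun ha hb j => by
    rw [ContinuousLinearMap.comp_add]; exact (G j).add_mem (ha j) (hb j)
  zero_mem' := fun j => by rw [ContinuousLinearMap.comp_zero]; exact (G j).zero_mem
  smul_mem' := fun c a ha j => by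
    rw [ContinuousLinearMap.comp_smul]; exact (G j).smul_mem c (ha j)

/-- The space of weakly unconditionally Cauchy series `∑ g_j` in the dual of `X` with `g_j ∈ G j`.
The norm `sup {∑ |g_j x| : ‖x‖ ≤ 1}` is the norm of `x ↦ (g_j x)_j` as an operator into `ℓ₁`. -/
def WUCSeries (G : ℕ → Submodule ℝ (StrongDual ℝ X)) : Type _ := wucSubmodule G

namespace WUCSeries

variable {G : ℕ → Submodule ℝ (StrongDual ℝ X)}

noncomputable instance : NormedAddCommGroup (WUCSeries G) :=
  Submodule.normedAddCommGroup (wucSubmodule G)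

noncomputable instance : NormedSpace ℝ (WUCSeries G) := Submodule.normedSpace (wucSubmodule G)

variable (G) in
/-- A weakly unconditionally Cauchy series as an operator into `ℓ₁`. -/
def toOp : WUCSeries G →ₗᵢ[ℝ] X →L[ℝ] lp (fun _ : ℕ => ℝ) 1 where
  toFun := Subtype.val
  map_add' _ _ := rfl
  map_smul' _ _ := rfl
  norm_map' _ := rfl

/-- The `j`-th term of a weakly unconditionally Cauchy series. -/
noncomputable def coord (j : ℕ) : WUCSeries G →ₗ[ℝ] StrongDual ℝ X where
  toFun v := (lp.evalCLM ℝ (fun _ : ℕ => ℝ) 1 j).comp (toOp G v)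
  map_add' v w := by rw [map_add, ContinuousLinearMap.comp_add]
  map_smul' c v := by rw [map_smul, ContinuousLinearMap.comp_smul]; rfl

theorem coord_mem (j : ℕ) (v : WUCSeries G) : coord j v ∈ G j := Subtype.property v j

theorem toOp_apply (v : WUCSeries G) (x : X) (j : ℕ) : toOp G v x j = coord j v x := rfl

theorem ext_coord {v w : WUCSeries G} (h : ∀ j, coord j v = coord j w) : v = w := by
  refine (toOp G).injective ?_
  ext x j
  exact DFunLike.congr_fun (h j) x

theorem sum_abs_coord_le (v : WUCSeries G) (F : Finset ℕ) (x : X) :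
    ∑ j ∈ F, |coord j v x| ≤ ‖v‖ * ‖x‖ :=
  (sum_abs_le_norm (toOp G v x) F).trans ((toOp G v).le_opNorm x)

theorem norm_le_of_sum_abs_coord_le {v : WUCSeries G} {C : ℝ} (hC : 0 ≤ C)
    (h : ∀ (F : Finset ℕ) x, ∑ j ∈ F, |coord j v x| ≤ C * ‖x‖) : ‖v‖ ≤ C :=
  (toOp G v).opNorm_le_bound hC fun x =>
    norm_le_of_forall_sum_abs_le (by positivity) fun F => h F x

/-- The weakly unconditionally Cauchy series with terms `g j`. -/
noncomputable def mk (g : ℕ → StrongDual ℝ X) (hg : ∀ j, g j ∈ G j) (C : ℝ)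
    (h : ∀ (F : Finset ℕ) x, ∑ j ∈ F, |g j x| ≤ C * ‖x‖) : WUCSeries G :=
  Subtype.mk (ellOneOperator g C h) fun j => hg j

@[simp]
theorem coord_mk (g : ℕ → StrongDual ℝ X) (hg : ∀ j, g j ∈ G j) (C : ℝ) (h) (j : ℕ) :
    coord j (mk g hg C h) = g j := rfl

theorem norm_mk_le (g : ℕ → StrongDual ℝ X) (hg : ∀ j, g j ∈ G j) {C : ℝ} (hC : 0 ≤ C) (h) :
    ‖mk g hg C h‖ ≤ C :=
  norm_le_of_sum_abs_coord_le hC h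

/-- The projection onto the `i`-th term. -/
noncomputable def proj (i : ℕ) : WUCSeries G →L[ℝ] WUCSeries G :=
  have h : ∀ (v : WUCSeries G) (F : Finset ℕ) x,
      ∑ j ∈ F, |(if j = i then coord j v else 0) x| ≤ ‖v‖ * ‖x‖ := fun v F x => by
    refine le_trans (Finset.sum_le_sum fun j _ => ?_) (sum_abs_coord_le v F x)
    split_ifs <;> simp
  LinearMap.mkContinuous
    { toFun := fun v => mk (fun j => if j = i then coord j v else 0) (fun j => by
        split_ifs
        exacts [coord_mem j v, (G j).zero_mem]) ‖v‖ (h v)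
      map_add' := fun v w => ext_coord fun j => by
        rw [map_add, coord_mk, coord_mk, coord_mk, map_add]; split_ifs <;> simp
      map_smul' := fun c v => ext_coord fun j => by
        rw [map_smul, coord_mk, coord_mk, map_smul]; split_ifs <;> simp } 1
    (fun v => by
      rw [one_mul]
      exact norm_mk_le _ _ (norm_nonneg _) _)

theorem coord_proj (i j : ℕ) (v : WUCSeries G) :
    coord j (proj i v) = if j = i then coord j v else 0 := rfl

theorem coord_sum_smul_proj (ε : ℕ → ℝ) (n j : ℕ) (v : WUCSeries G) :
    coord j ((∑ i ∈ Finset.range n, ε i • proj i : WUCSeries G →L[ℝ] WUCSeries G) v) =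
      if j < n then ε j • coord j v else 0 := by
  simp only [_root_.sum_apply, _root_.smul_apply, map_sum, map_smul, coord_proj, smul_ite,
    smul_zero, Finset.sum_ite_eq, Finset.mem_range]

theorem coord_sum_proj (n j : ℕ) (v : WUCSeries G) :
    coord j (∑ i ∈ Finset.range n, proj i v) = if j < n then coord j v else 0 := by
  simp only [map_sum, coord_proj, Finset.sum_ite_eq, Finset.mem_range]

theorem coord_sub_sum_proj (n j : ℕ) (v : WUCSeries G) :
    coord j (v - ∑ i ∈ Finset.range n, proj i v) = if j < n then 0 else coord j v := by
  rw [map_sub, coord_sum_proj]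
  split_ifs <;> simp

theorem norm_sum_smul_proj_le {ε : ℕ → ℝ} (hε : ∀ j, ε j = 1 ∨ ε j = -1) (n : ℕ) :
    ‖(∑ i ∈ Finset.range n, ε i • proj i : WUCSeries G →L[ℝ] WUCSeries G)‖ ≤ 1 := by
  refine ContinuousLinearMap.opNorm_le_bound _ zero_le_one fun v => ?_
  rw [one_mul]
  refine norm_le_of_sum_abs_coord_le (norm_nonneg _) fun F x => ?_
  refine le_trans (Finset.sum_le_sum fun j _ => ?_) (sum_abs_coord_le v F x)
  rw [coord_sum_smul_proj]
  split_ifs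
  · rcases hε j with h | h <;> simp [h]
  · simp

/-- The remainders of a weakly unconditionally Cauchy series decrease in norm. -/
theorem norm_sub_sum_proj_antitone (v : WUCSeries G) :
    Antitone fun n => ‖v - ∑ i ∈ Finset.range n, proj i v‖ := by
  intro m n hmn
  refine norm_le_of_sum_abs_coord_le (norm_nonneg _) fun F x => ?_
  refine le_trans (Finset.sum_le_sum fun j _ => ?_)
    (sum_abs_coord_le (v - ∑ i ∈ Finset.range m, proj i v) F x)
  rw [coord_sub_sum_proj, coord_sub_sum_proj]
  split_ifs
  · simp
  · simp
  · omega
  · exact le_rfl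

/-- If weakly unconditionally Cauchy series in the dual of `X` have null terms, they converge in
the norm of `WUCSeries G`: otherwise signed sums of blocks of terms form such a series whose terms
are bounded away from zero. -/
theorem tendsto_sum_proj (hX : DualWUCNull X) (v : WUCSeries G) :
    Tendsto (fun n => ∑ i ∈ Finset.range n, proj i v) atTop (𝓝 v) := by
  by_contra hcon
  rw [Metric.tendsto_atTop] at hcon
  push Not at hcon
  obtain ⟨η, hη, hcon⟩ := hcon
  have htail : ∀ N, η ≤ ‖v - ∑ i ∈ Finset.range N, proj i v‖ := fun N => by
    obtain ⟨n, hn, h⟩ := hcon N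
    rw [dist_comm, dist_eq_norm] at h
    exact h.trans (norm_sub_sum_proj_antitone v hn)
  have hblock : ∀ N, ∃ (F : Finset ℕ) (s : ℕ → ℝ), (∀ j ∈ F, N ≤ j) ∧ (∀ j, |s j| ≤ 1) ∧
      η / 2 ≤ ‖∑ j ∈ F, s j • coord j v‖ := fun N => by
    have h1 : ∃ (F : Finset ℕ) (x : X), η / 2 * ‖x‖ <
        ∑ j ∈ F, |coord j (v - ∑ i ∈ Finset.range N, proj i v) x| := by
      by_contra! hno
      have := norm_le_of_sum_abs_coord_le (half_pos hη).le hno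
      linarith [htail N]
    obtain ⟨F, x, hFx⟩ := h1
    refine ⟨F.filter fun j => N ≤ j, fun j => (SignType.sign (coord j v x) : ℝ), by simp,
      fun j => ?_, ?_⟩
    · rcases lt_trichotomy (coord j v x) 0 with h | h | h <;> simp [h]
    · have h2 : ∑ j ∈ F, |coord j (v - ∑ i ∈ Finset.range N, proj i v) x| =
          (∑ j ∈ F.filter fun j => N ≤ j, (SignType.sign (coord j v x) : ℝ) • coord j v) x := by
        rw [_root_.sum_apply, Finset.sum_filter]
        refine Finset.sum_congr rfl fun j _ => ?_
        rw [coord_sub_sum_proj]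
        by_cases hj : N ≤ j
        · rw [if_neg (not_lt.2 hj), if_pos hj, _root_.smul_apply, smul_eq_mul, sign_mul_self]
        · rw [if_pos (not_le.1 hj), if_neg hj]; simp
      rw [h2] at hFx
      have h3 := hFx.trans_le ((Real.le_norm_self _).trans (ContinuousLinearMap.le_opNorm _ x))
      exact (lt_of_mul_lt_mul_right h3 (norm_nonneg _)).le
  choose F s hF hs hη' using hblock
  let N : ℕ → ℕ := fun k => Nat.rec 0 (fun _ m => (F m).sup id + m + 1) k
  have hN : ∀ k, N (k + 1) = (F (N k)).sup id + N k + 1 := fun _ => rfl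
  have hNmono : StrictMono N := strictMono_nat_of_lt_succ fun k => by rw [hN]; omega
  have hFlt : ∀ k, ∀ j ∈ F (N k), j < N (k + 1) := fun k j hj => by
    have : j ≤ (F (N k)).sup id := Finset.le_sup (f := id) hj
    rw [hN]; omega
  have hdisj : ∀ k l, k ≠ l → Disjoint (F (N k)) (F (N l)) := by
    have : ∀ k l, k < l → Disjoint (F (N k)) (F (N l)) := fun k l hkl => by
      rw [Finset.disjoint_left]
      intro j hj hj'
      exact absurd ((hFlt k j hj).trans_le ((hNmono.monotone hkl).trans (hF _ _ hj')))
        (lt_irrefl _)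
    intro k l hkl
    rcases lt_or_gt_of_ne hkl with h | h
    exacts [this k l h, (this l k h).symm]
  have h0 := hX (fun k => ∑ j ∈ F (N k), s (N k) j • coord j v) ‖v‖ (fun K x => by
    refine le_trans (Finset.sum_le_sum fun k _ => ?_)
      ((Finset.sum_biUnion (f := fun j => |coord j v x|) (s := K) (t := fun k => F (N k))
        (fun k _ l _ hkl => hdisj k l hkl)).symm.le.trans (sum_abs_coord_le v _ x))
    rw [_root_.sum_apply]
    refine (Finset.abs_sum_le_sum_abs _ _).trans (Finset.sum_le_sum fun j _ => ?_)
    rw [_root_.smul_apply, smul_eq_mul, abs_mul]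
    exact mul_le_of_le_one_left (abs_nonneg _) (hs _ _))
  obtain ⟨k, hk⟩ := ((tendsto_zero_iff_norm_tendsto_zero.1 h0).eventually_lt_const
    (half_pos hη)).exists
  exact absurd hk (not_lt.2 (hη' (N k)))

theorem isBoundedlyCompleteUFDD_proj (hX : DualWUCNull X) (hG : ∀ j, FiniteDimensional ℝ (G j)) :
    IsBoundedlyCompleteUFDD (proj : ℕ → WUCSeries G →L[ℝ] WUCSeries G) where
  finiteRank j := by
    have := hG j
    refine FiniteDimensional.of_injective (V₂ := G j)
      (((coord j).comp (Submodule.subtype _)).codRestrict _ fun v => coord_mem j _) ?_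
    rintro ⟨_, v, rfl⟩ ⟨_, w, rfl⟩ hvw
    have h := congrArg Subtype.val hvw
    refine Subtype.ext (ext_coord fun i => ?_)
    by_cases hi : i = j
    · subst hi; exact h
    · exact ((coord_proj j i v).trans (if_neg hi)).trans
        ((coord_proj j i w).trans (if_neg hi)).symm
  idem j := by
    ext v : 1
    refine ext_coord fun i => ?_
    rw [ContinuousLinearMap.comp_apply, coord_proj, coord_proj]
    split_ifs <;> rfl
  orth i j hij := by
    ext v : 1
    refine ext_coord fun k => ?_
    rw [ContinuousLinearMap.comp_apply, coord_proj, coord_proj, zero_apply, map_zero]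
    split_ifs with h1 h2
    · exact absurd (h1.symm.trans h2) hij
    all_goals rfl
  tendsto_sum := tendsto_sum_proj hX
  norm_signed_le _ hε n := norm_sum_smul_proj_le hε n
  exists_of_bounded g C hg hC := by
    have h1 : ∀ i j, coord i (g j) = if i = j then coord i (g i) else 0 := fun i j => by
      rw [← hg j, coord_proj]
      split_ifs with h
      · rw [h]
      · rfl
    refine ⟨mk (fun j => coord j (g j)) (fun j => coord_mem j _) C fun F x => ?_, fun j => ?_⟩
    · have h2 : ∀ n i, i < n → coord i (∑ j ∈ Finset.range n, g j) = coord i (g i) :=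
        fun n i hi => by
          rw [map_sum, Finset.sum_congr rfl fun j _ => h1 i j, Finset.sum_ite_eq,
            if_pos (Finset.mem_range.2 hi)]
      have h3 := (sum_abs_coord_le (∑ j ∈ Finset.range (F.sup id + 1), g j) F x).trans
        (mul_le_mul_of_nonneg_right (hC _) (norm_nonneg x))
      refine le_trans (Finset.sum_le_sum fun i hi => ?_) h3
      rw [h2 _ i (Nat.lt_succ_of_le (Finset.le_sup (f := id) hi))]
    · refine ext_coord fun i => ?_
      rw [coord_proj, coord_mk, h1 i j]

/-- In the reflexive case every functional on `WUCSeries G` belongs to the norm closed span of the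
adjoint ranges of the projections: a series `v` is the continuous function
`(ε, x) ↦ ∑ ε_j g_j x` on the product of a cube and the weakly compact unit ball of `X`, and the
remainders of a bounded sequence of series tend to zero pointwise there. -/
theorem mem_dualPart_of_isReflexiveSpace (hX : DualWUCNull X) (hr : IsReflexiveSpace X)
    (hd : Dense {x : X | ∀ᶠ j in atTop, ∀ g ∈ G j, g x = 0}) (φ : StrongDual ℝ (WUCSeries G)) :
    φ ∈ dualPart (proj : ℕ → WUCSeries G →L[ℝ] WUCSeries G) := by
  let B : Set (WeakDual ℝ (StrongDual ℝ X)) := WeakDual.toStrongDual ⁻¹' Metric.closedBall 0 1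
  have hB : CompactSpace B := isCompact_iff_compactSpace.1 (WeakDual.isCompact_closedBall 0 1)
  have hB0 : Nonempty B := ⟨⟨0, by simp [B]⟩⟩
  let K := (ℕ → Set.Icc (-1 : ℝ) 1) × B
  have hK : Nonempty K := ⟨(fun _ => ⟨0, by simp⟩, hB0.some)⟩
  -- points of `B` are evaluations at points of the unit ball of `X`
  have hev : ∀ ξ : B, ∃ x : X, ‖x‖ ≤ 1 ∧ ∀ g : StrongDual ℝ X, ξ.1 g = g x := fun ξ => by
    obtain ⟨x, hx⟩ := hr (WeakDual.toStrongDual ξ.1)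
    refine ⟨x, ?_, fun g => ?_⟩
    · rw [← (NormedSpace.inclusionInDoubleDualLi (𝕜 := ℝ) (E := X)).norm_map]
      exact (congrArg norm hx).le.trans (WeakDual.mem_preimage_closedBall_iff.1 ξ.2)
    · rw [← NormedSpace.dual_def ℝ X x g, hx]; rfl
  choose pt hpt hpt' using hev
  have hbd : ∀ (v : WUCSeries G) (k : K) (F : Finset ℕ), ∑ j ∈ F, |k.2.1 (coord j v)| ≤ ‖v‖ :=
    fun v k F => by
      simp only [hpt']
      exact (sum_abs_coord_le v F (pt k.2)).trans
        (mul_le_of_le_one_right (norm_nonneg _) (hpt _))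
  have hone : ∀ (k : K) j, |(k.1 j : ℝ)| ≤ 1 := fun k j => abs_le.2 (k.1 j).2
  have hsum : ∀ (v : WUCSeries G) (k : K), Summable fun j => (k.1 j : ℝ) * k.2.1 (coord j v) :=
    fun v k => summable_mul_of_sum_abs_le (hone k) (hbd v k)
  have hle : ∀ (v : WUCSeries G) (k : K), |∑' j, (k.1 j : ℝ) * k.2.1 (coord j v)| ≤ ‖v‖ :=
    fun v k => abs_tsum_mul_le (hone k) (hbd v k)
  have hadd : ∀ (v w : WUCSeries G) (k : K), ∑' j, (k.1 j : ℝ) * k.2.1 (coord j (v + w)) =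
      ∑' j, (k.1 j : ℝ) * k.2.1 (coord j v) + ∑' j, (k.1 j : ℝ) * k.2.1 (coord j w) :=
    fun v w k => by
      rw [← (hsum v k).tsum_add (hsum w k)]
      refine tsum_congr fun j => ?_
      rw [map_add, map_add, mul_add]
  have hsmul : ∀ (c : ℝ) (v : WUCSeries G) (k : K), ∑' j, (k.1 j : ℝ) * k.2.1 (coord j (c • v)) =
      c * ∑' j, (k.1 j : ℝ) * k.2.1 (coord j v) := fun c v k => by
    rw [← tsum_mul_left]
    refine tsum_congr fun j => ?_
    rw [map_smul, map_smul, smul_eq_mul]; ring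
  have hfin : ∀ (v : WUCSeries G) n, Continuous fun k : K =>
      ∑' j, (k.1 j : ℝ) * k.2.1 (coord j (∑ i ∈ Finset.range n, proj i v)) := fun v n => by
    have : ∀ k : K, ∑' j, (k.1 j : ℝ) * k.2.1 (coord j (∑ i ∈ Finset.range n, proj i v)) =
        ∑ j ∈ Finset.range n, (k.1 j : ℝ) * k.2.1 (coord j v) := fun k => by
      rw [tsum_eq_sum (s := Finset.range n) (fun j hj => by
        rw [coord_sum_proj, if_neg (fun h => hj (Finset.mem_range.2 h)), map_zero, mul_zero])]
      refine Finset.sum_congr rfl fun j hj => ?_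
      rw [coord_sum_proj, if_pos (Finset.mem_range.1 hj)]
    simp only [this]
    refine continuous_finsetSum _ fun j _ => Continuous.mul ?_ ?_
    · exact continuous_subtype_val.comp ((continuous_apply j).comp continuous_fst)
    · exact (WeakDual.eval_continuous _).comp (continuous_subtype_val.comp continuous_snd)
  have hcont : ∀ v : WUCSeries G, Continuous fun k : K =>
      ∑' j, (k.1 j : ℝ) * k.2.1 (coord j v) := fun v => by
    refine TendstoUniformly.continuous (F := fun n (k : K) =>
      ∑' j, (k.1 j : ℝ) * k.2.1 (coord j (∑ i ∈ Finset.range n, proj i v))) (p := atTop) ?_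
      (Frequently.of_forall (hfin v))
    rw [Metric.tendstoUniformly_iff]
    intro η hη
    filter_upwards [Metric.tendsto_nhds.1 (tendsto_sum_proj hX v) η hη] with n hn k
    have h1 := hle (v - ∑ i ∈ Finset.range n, proj i v) k
    have h2 := hadd (v - ∑ i ∈ Finset.range n, proj i v) (∑ i ∈ Finset.range n, proj i v) k
    rw [sub_add_cancel] at h2
    rw [Real.dist_eq, h2, add_sub_cancel_right]
    rw [dist_comm, dist_eq_norm] at hn
    exact h1.trans_lt hn
  let h : WUCSeries G →ₗ[ℝ] C(K, ℝ) :=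
    { toFun := fun v => ⟨_, hcont v⟩
      map_add' := fun v w => ContinuousMap.ext (hadd v w)
      map_smul' := fun c v => ContinuousMap.ext (hsmul c v) }
  have hlt : ∀ (v : WUCSeries G) a, a < ‖v‖ → ∃ k, a < h v k := fun v a ha => by
    rcases lt_or_ge a 0 with ha0 | ha0
    · refine ⟨(fun _ => ⟨0, by simp⟩, ⟨0, by simp [B]⟩), ha0.trans_le (le_of_eq ?_)⟩
      change (0 : ℝ) = ∑' j, (0 : ℝ) * _
      simp
    obtain ⟨b, hab, hb⟩ := exists_between ha
    have h1 : ∃ x, ‖x‖ ≤ 1 ∧ b < ‖toOp G v x‖ := by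
      by_contra! hcon
      exact absurd hb (not_lt.2 ((toOp G v).opNorm_le_of_unit_norm (𝕜 := ℝ) (ha0.trans hab.le)
        fun x hx => hcon x hx.le))
    obtain ⟨x, hx, hbx⟩ := h1
    let ξ : B := ⟨StrongDual.toWeakDual (NormedSpace.inclusionInDoubleDual ℝ X x), by
      exact WeakDual.mem_preimage_closedBall_iff.2
        ((NormedSpace.double_dual_bound ℝ X x).trans hx)⟩
    refine ⟨(fun j => ⟨(SignType.sign (coord j v x) : ℝ), ?_⟩, ξ), hab.trans ?_⟩
    · rcases lt_trichotomy (coord j v x) 0 with h | h | h <;> simp [h]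
    · have h3 : ‖toOp G v x‖ = ∑' j, |coord j v x| := by
        simpa [toOp_apply] using lp.norm_eq_tsum_rpow (p := 1) (by simp) (toOp G v x)
      have h4 : h v (fun j => ⟨(SignType.sign (coord j v x) : ℝ), by
          rcases lt_trichotomy (coord j v x) 0 with h | h | h <;> simp [h]⟩, ξ) =
          ∑' j, |coord j v x| :=
        tsum_congr fun j => sign_mul_self (coord j v x)
      rw [h4, ← h3]
      exact hbx
  rw [mem_dualPart]
  by_contra hcon
  rw [Metric.tendsto_atTop] at hcon
  push Not at hcon
  obtain ⟨η, hη, hcon⟩ := hcon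
  have hw : ∀ N, ∃ w : WUCSeries G, ‖w‖ ≤ 2 ∧ (∀ j < N, coord j w = 0) ∧ η / 2 ≤ |φ w| :=
    fun N => by
      obtain ⟨n, hn, h1⟩ := hcon N
      rw [dist_comm, dist_eq_norm] at h1
      obtain ⟨v, hv, hv'⟩ := exists_norm_le_one_lt_abs (half_pos hη).le
        ((half_lt_self hη).trans_le h1)
      refine ⟨v - ∑ i ∈ Finset.range n, proj i v, ?_, fun j hj => ?_, ?_⟩
      · refine (norm_sub_sum_proj_antitone v (Nat.zero_le n)).trans ?_
        simpa using hv.trans one_le_two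
      · rw [coord_sub_sum_proj, if_pos (hj.trans_le hn)]
      · refine hv'.le.trans (le_of_eq ?_)
        rw [map_sub]
        simp [_root_.sum_apply]
  choose w hw1 hw2 hw3 using hw
  have h0 := tendsto_zero_of_pointwise h hle hlt φ hw1 (fun k => by
    -- approximate the point of the unit ball by one on which all but finitely many `G j` vanish
    rw [Metric.tendsto_atTop]
    intro r hr
    obtain ⟨y, hy, hxy⟩ := Metric.dense_iff.1 hd (pt k.2) (r / 4) (by positivity)
    obtain ⟨M, hM⟩ := eventually_atTop.1 hxy
    refine ⟨M, fun n hn => ?_⟩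
    rw [dist_zero_right]
    have h1 : |h (w n) k| ≤ 2 * ‖pt k.2 - y‖ := by
      refine abs_tsum_mul_le (hone k) fun F => ?_
      refine le_trans (Finset.sum_le_sum fun j _ => ?_)
        ((sum_abs_coord_le (w n) F (pt k.2 - y)).trans
          (mul_le_mul_of_nonneg_right (hw1 n) (norm_nonneg _)))
      rw [hpt', map_sub]
      by_cases hj : j < n
      · rw [hw2 n j hj]; simp
      · rw [hM j (hn.trans (not_lt.1 hj)) _ (coord_mem j (w n)), sub_zero]
    rw [Real.norm_eq_abs]
    rw [Metric.mem_ball, dist_comm, dist_eq_norm] at hy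
    linarith)
  obtain ⟨n, hn⟩ := ((tendsto_zero_iff_norm_tendsto_zero.1 h0).eventually_lt_const
    (half_pos hη)).exists
  exact absurd hn (not_lt.2 (hw3 n))

end WUCSeries

end WUCSeries

/-! ### Expansions that are finite on a dense set -/

section Expansions

variable {X : Type*} [NormedAddCommGroup X] [NormedSpace ℝ X]
variable {Y : Type*} [NormedAddCommGroup Y] [NormedSpace ℝ Y]

/-- An unconditional expansion `J = ∑ A_j` into operators of finite rank, all of whose signed
partial sums have norm at most `c`, and such that `A_j x = 0` for all but finitely many `j` if `x`
belongs to a suitable dense set. -/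
structure IsFinitaryExpansion (J : X →L[ℝ] Y) (c : ℝ) (A : ℕ → X →L[ℝ] Y) : Prop where
  finiteRank : ∀ n, FiniteDimensional ℝ (A n).toLinearMap.range
  norm_signed_sum_le : ∀ (ε : ℕ → ℝ), (∀ j, ε j = 1 ∨ ε j = -1) → ∀ n : ℕ,
    ‖∑ j ∈ Finset.range n, ε j • A j‖ ≤ c
  dense : Dense {x | ∀ᶠ j in atTop, A j x = 0}
  tendsto_sum : ∀ x, Tendsto (fun n => ∑ j ∈ Finset.range n, A j x) atTop (𝓝 (J x))

theorem finiteDimensional_range_add {A B : X →L[ℝ] Y}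
    (hA : FiniteDimensional ℝ A.toLinearMap.range) (hB : FiniteDimensional ℝ B.toLinearMap.range) :
    FiniteDimensional ℝ (A + B).toLinearMap.range := by
  refine Submodule.finiteDimensional_of_le (S₂ := A.toLinearMap.range ⊔ B.toLinearMap.range) ?_
  rintro _ ⟨x, rfl⟩
  exact Submodule.add_mem_sup ⟨x, rfl⟩ ⟨x, rfl⟩

theorem finiteDimensional_range_comp_right {Z : Type*} [NormedAddCommGroup Z] [NormedSpace ℝ Z]
    {A : X →L[ℝ] Y} (B : Y →L[ℝ] Z) (hA : FiniteDimensional ℝ A.toLinearMap.range) :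
    FiniteDimensional ℝ (B.comp A).toLinearMap.range := by
  refine Submodule.finiteDimensional_of_le (S₂ := A.toLinearMap.range.map B.toLinearMap) ?_
  rintro _ ⟨x, rfl⟩
  exact ⟨A x, ⟨x, rfl⟩, rfl⟩

theorem finiteDimensional_range_sub {A B : X →L[ℝ] Y}
    (hA : FiniteDimensional ℝ A.toLinearMap.range) (hB : FiniteDimensional ℝ B.toLinearMap.range) :
    FiniteDimensional ℝ (A - B).toLinearMap.range := by
  refine Submodule.finiteDimensional_of_le (S₂ := A.toLinearMap.range ⊔ B.toLinearMap.range) ?_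
  rintro _ ⟨x, rfl⟩
  exact Submodule.sub_mem _ (Submodule.mem_sup_left ⟨x, rfl⟩) (Submodule.mem_sup_right ⟨x, rfl⟩)

theorem finiteDimensional_range_zero :
    FiniteDimensional ℝ (0 : X →L[ℝ] Y).toLinearMap.range := by
  refine Submodule.finiteDimensional_of_le (S₂ := (⊥ : Submodule ℝ Y)) ?_
  rintro _ ⟨x, rfl⟩
  simp

theorem finiteDimensional_range_sum {A : ℕ → X →L[ℝ] Y}
    (hA : ∀ n, FiniteDimensional ℝ (A n).toLinearMap.range) (n : ℕ) :
    FiniteDimensional ℝ (∑ j ∈ Finset.range n, A j).toLinearMap.range := by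
  induction n with
  | zero =>
    rw [Finset.sum_range_zero]
    exact finiteDimensional_range_zero
  | succ n ih =>
    rw [Finset.sum_range_succ]
    exact finiteDimensional_range_add ih (hA n)

/-- Operators of finite rank that tend to `J` strongly can be perturbed, by less and less in norm,
so as to agree with `J` on a given finite-dimensional subspace. -/
theorem exists_perturbation {J : X →L[ℝ] Y} {U : ℕ → X →L[ℝ] Y}
    (hU : ∀ n, FiniteDimensional ℝ (U n).toLinearMap.range)
    (hJ : ∀ x, Tendsto (fun n => U n x) atTop (𝓝 (J x))) (F : Submodule ℝ X)
    [FiniteDimensional ℝ F] : ∃ V : ℕ → X →L[ℝ] Y,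
      (∀ n, FiniteDimensional ℝ (V n).toLinearMap.range) ∧ (∀ n, ∀ x ∈ F, V n x = J x) ∧
      Tendsto (fun n => ‖V n - U n‖) atTop (𝓝 0) := by
  obtain ⟨R, hR⟩ := Submodule.ClosedComplemented.of_finiteDimensional F
  let R' : X →L[ℝ] X := F.subtypeL.comp R
  have hR' : FiniteDimensional ℝ R'.toLinearMap.range := by
    refine Submodule.finiteDimensional_of_le (S₂ := F) ?_
    rintro _ ⟨x, rfl⟩
    exact (R x).2
  refine ⟨fun n => U n + (J - U n).comp R', fun n => finiteDimensional_range_add (hU n)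
    (finiteDimensional_range_comp_right _ hR'), fun n x hx => ?_, ?_⟩
  · have : R' x = x := congrArg Subtype.val (hR ⟨x, hx⟩)
    simp [this]
  · simp only [add_sub_cancel_left]
    let b := Module.finBasis ℝ F
    obtain ⟨C, hC, hb⟩ := b.exists_opNorm_le (F := Y)
    have h1 : Tendsto (fun n => ∑ i, ‖(J - U n) (b i : X)‖) atTop (𝓝 0) := by
      rw [← Finset.sum_const_zero (s := (Finset.univ : Finset (Fin (Module.finrank ℝ F))))]
      refine tendsto_finsetSum _ fun i _ => ?_
      have := (tendsto_const_nhds (x := J (b i : X))).sub (hJ (b i))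
      simpa using this.norm
    have h2 := (h1.const_mul C).mul_const ‖R‖
    rw [mul_zero, zero_mul] at h2
    refine squeeze_zero (fun _ => norm_nonneg _) (fun n => ?_) h2
    have h3 : (J - U n).comp R' = ((J - U n).comp F.subtypeL).comp R := rfl
    rw [h3]
    refine (ContinuousLinearMap.opNorm_comp_le _ _).trans
      (mul_le_mul_of_nonneg_right ?_ (norm_nonneg _))
    refine hb (Finset.sum_nonneg fun _ _ => norm_nonneg _) fun i => ?_
    exact Finset.single_le_sum (f := fun i => ‖(J - U n) (b i : X)‖)
      (fun _ _ => norm_nonneg _) (Finset.mem_univ i)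

/-- Operators that agree with `J` on more and more members of a dense sequence are the partial
sums of a finitary expansion of `J`. -/
theorem isFinitaryExpansion_of_partialSums {J : X →L[ℝ] Y} {c : ℝ} {V : ℕ → X →L[ℝ] Y} {d : ℕ → X}
    (hd : DenseRange d) (h0 : V 0 = 0) (hV : ∀ n, FiniteDimensional ℝ (V n).toLinearMap.range)
    (hJ : ∀ i n, i < n → V (n + 1) (d i) = J (d i))
    (hc : ∀ (ε : ℕ → ℝ), (∀ j, ε j = 1 ∨ ε j = -1) → ∀ n : ℕ,
      ‖∑ j ∈ Finset.range n, ε j • (V (j + 1) - V j)‖ ≤ c) :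
    IsFinitaryExpansion J c fun j => V (j + 1) - V j where
  finiteRank n := finiteDimensional_range_sub (hV _) (hV _)
  norm_signed_sum_le := hc
  dense := by
    refine hd.mono ?_
    rintro _ ⟨i, rfl⟩
    filter_upwards [eventually_gt_atTop (i + 1)] with j hj
    obtain ⟨k, rfl⟩ := Nat.exists_eq_add_of_lt hj
    rw [_root_.sub_apply, hJ i _ (by omega), hJ i _ (by omega), sub_self]
  tendsto_sum x := by
    have hsum : ∀ n, ∑ j ∈ Finset.range n, (V (j + 1) - V j) = V n := fun n => by
      rw [Finset.sum_range_sub, h0, sub_zero]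
    have hVc : ∀ n, ‖V n‖ ≤ c := fun n => by
      simpa [hsum] using hc (fun _ => 1) (fun _ => Or.inl rfl) n
    have hc0 : 0 ≤ c := (norm_nonneg _).trans (hVc 0)
    simp only [← _root_.sum_apply, hsum]
    rw [Metric.tendsto_atTop]
    intro η hη
    have hpos : 0 < c + ‖J‖ + 1 := by positivity
    obtain ⟨i, hi⟩ := hd.exists_dist_lt x (div_pos hη hpos)
    refine ⟨i + 2, fun n hn => ?_⟩
    obtain ⟨k, rfl⟩ := Nat.exists_eq_add_of_le' (Nat.one_le_of_lt hn)
    rw [dist_eq_norm] at hi ⊢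
    have h1 : V (k + 1) x - J x = V (k + 1) (x - d i) - J (x - d i) := by
      rw [map_sub, map_sub, hJ i k (by omega)]; abel
    rw [h1]
    have h2 := (V (k + 1)).le_of_opNorm_le (hVc _) (x - d i)
    have h3 := J.le_opNorm (x - d i)
    rw [lt_div_iff₀ hpos] at hi
    have h4 := norm_sub_le (V (k + 1) (x - d i)) (J (x - d i))
    have h5 := norm_nonneg (x - d i)
    nlinarith

/-- Signs that are constant on the blocks `[m j, m (j + 1))`. -/
theorem exists_sign_sum_blocks {E : Type*} [AddCommGroup E] [Module ℝ E] (A : ℕ → E) {m : ℕ → ℕ}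
    (hm : Monotone m) (h0 : m 0 = 0) {ε : ℕ → ℝ} (hε : ∀ j, ε j = 1 ∨ ε j = -1) (n : ℕ) :
    ∃ θ : ℕ → ℝ, (∀ j, θ j = 1 ∨ θ j = -1) ∧
      ∑ j ∈ Finset.range n, ε j • (∑ i ∈ Finset.range (m (j + 1)), A i -
        ∑ i ∈ Finset.range (m j), A i) = ∑ i ∈ Finset.range (m n), θ i • A i := by
  induction n with
  | zero => exact ⟨fun _ => 1, fun _ => Or.inl rfl, by simp [h0]⟩
  | succ n ih =>
    obtain ⟨θ, hθ, h⟩ := ih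
    refine ⟨fun i => if i < m n then θ i else ε n, fun j => ?_, ?_⟩
    · dsimp only
      split_ifs
      exacts [hθ j, hε n]
    · rw [Finset.sum_range_succ, h, ← Finset.sum_range_add_sum_Ico _ (hm n.le_succ),
        ← Finset.sum_range_add_sum_Ico (fun i => (if i < m n then θ i else ε n) • A i)
          (hm n.le_succ), add_sub_cancel_left, Finset.smul_sum]
      congr 1
      · refine Finset.sum_congr rfl fun i hi => ?_
        rw [if_pos (Finset.mem_range.1 hi)]
      · refine Finset.sum_congr rfl fun i hi => ?_
        rw [if_neg (not_lt.2 (Finset.mem_Ico.1 hi).1)]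

theorem sum_geometric_bound {η : ℝ} (hη : 0 ≤ η) (n : ℕ) :
    ∑ j ∈ Finset.range n, η / 2 * (1 / 2) ^ j ≤ η := by
  rw [← Finset.mul_sum]
  have := sum_geometric_two_le n
  nlinarith

theorem IsUnconditionalExpansion.exists_isFinitaryExpansion [TopologicalSpace.SeparableSpace X]
    {J : X →ₗᵢ[ℝ] Y} {δ : ℝ} {A : ℕ → X →L[ℝ] Y} (hA : IsUnconditionalExpansion J δ A) {η : ℝ}
    (hη : 0 < η) :
    ∃ A', IsFinitaryExpansion J.toContinuousLinearMap (1 + δ + η) A' := by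
  obtain ⟨d, hd⟩ := TopologicalSpace.exists_dense_seq X
  let U : ℕ → X →L[ℝ] Y := fun n => ∑ j ∈ Finset.range n, A j
  have hU : ∀ n, FiniteDimensional ℝ (U n).toLinearMap.range :=
    finiteDimensional_range_sum hA.finiteRank
  have hUJ : ∀ x, Tendsto (fun n => U n x) atTop (𝓝 (J.toContinuousLinearMap x)) := fun x => by
    simpa [U, _root_.sum_apply] using hA.tendsto_sum x
  let F : ℕ → Submodule ℝ X := fun n => Submodule.span ℝ (d '' Set.Iio n)
  have hF : ∀ n, FiniteDimensional ℝ (F n) := fun n =>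
    FiniteDimensional.span_of_finite ℝ ((Set.finite_Iio n).image d)
  have hstep : ∀ n M, ∃ (m : ℕ) (V : X →L[ℝ] Y), M ≤ m ∧
      FiniteDimensional ℝ V.toLinearMap.range ∧ (∀ x ∈ F n, V x = J x) ∧
      ‖V - U m‖ ≤ η / 6 * (1 / 2) ^ n := fun n M => by
    have := hF n
    obtain ⟨V, hV1, hV2, hV3⟩ := exists_perturbation hU hUJ (F n)
    have hpos : 0 < η / 6 * (1 / 2) ^ n := by positivity
    obtain ⟨m, hm1, hm2⟩ := ((eventually_ge_atTop M).and
      (hV3.eventually_lt_const hpos)).exists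
    exact ⟨m, V m, hm1, hV1 m, hV2 m, hm2.le⟩
  choose m V hm hV1 hV2 hV3 using hstep
  -- the indices `k n` and the operators `B n` close to `U (k n)`
  let k : ℕ → ℕ := fun n => Nat.rec 0 (fun n M => m n M) n
  let B : ℕ → X →L[ℝ] Y := fun n => Nat.casesOn n 0 fun n => V n (k n)
  have hk : ∀ n, k (n + 1) = m n (k n) := fun _ => rfl
  have hB : ∀ n, B (n + 1) = V n (k n) := fun _ => rfl
  have hkmono : Monotone k := monotone_nat_of_le_succ fun n => hm n (k n)
  have hE : ∀ n, ‖B n - U (k n)‖ ≤ 2 * (η / 6 * (1 / 2) ^ n) := fun n => by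
    cases n with
    | zero => simp [B, k, U]; positivity
    | succ n =>
      rw [hB, hk]
      refine (hV3 n (k n)).trans (le_of_eq ?_)
      rw [pow_succ]; ring
  refine ⟨_, isFinitaryExpansion_of_partialSums (V := B) hd rfl (fun n => ?_)
    (fun i n hin => ?_) fun ε hε n => ?_⟩
  · cases n with
    | zero => exact finiteDimensional_range_zero
    | succ n => exact hV1 n _
  · exact hV2 n _ _ (Submodule.subset_span ⟨i, hin, rfl⟩)
  · obtain ⟨θ, hθ, h⟩ := exists_sign_sum_blocks A hkmono rfl hε n
    have h1 : ∑ j ∈ Finset.range n, ε j • (B (j + 1) - B j) =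
        ∑ i ∈ Finset.range (k n), θ i • A i + ∑ j ∈ Finset.range n,
          ε j • ((B (j + 1) - U (k (j + 1))) - (B j - U (k j))) := by
      rw [← h, ← Finset.sum_add_distrib]
      refine Finset.sum_congr rfl fun j _ => ?_
      rw [← smul_add]
      congr 1
      simp only [U]
      abel
    rw [h1]
    refine (norm_add_le _ _).trans (add_le_add (hA.norm_signed_sum_lt θ hθ _).le ?_)
    refine (norm_sum_le _ _).trans (le_trans (Finset.sum_le_sum fun j _ => ?_)
      (sum_geometric_bound hη.le n))
    have h2 : ‖ε j‖ = 1 := by rcases hε j with h | h <;> simp [h]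
    rw [norm_smul, h2, one_mul]
    refine (norm_sub_le _ _).trans ((add_le_add (hE (j + 1)) (hE j)).trans (le_of_eq ?_))
    rw [pow_succ]; ring

/-- A space with the unconditional metric approximation property has finitary expansions of its
identity. Approximating operators `B n` with `B n * B k = B k` for `k < n` are chosen such that
the product of the norms of `1 - 2 * B n` is small; products of such factors then have the form
`1 - 2 * ∑ A_j` with the sum over a given set of differences `A_j = B (j + 1) - B j`. -/
theorem HasUMAP.exists_isFinitaryExpansion [TopologicalSpace.SeparableSpace X] (hX : HasUMAP X)
    {δ : ℝ} (hδ : 0 < δ) :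
    ∃ A, IsFinitaryExpansion (ContinuousLinearMap.id ℝ X) (1 + δ) A := by
  obtain ⟨T, hT, hT1, hT2⟩ := hX
  obtain ⟨d, hd⟩ := TopologicalSpace.exists_dense_seq X
  have hlog : 0 < Real.log (1 + δ) := Real.log_pos (by linarith)
  let r : ℕ → ℝ := fun n => Real.log (1 + δ) / 2 * (1 / 2) ^ n
  have hr : ∀ n, 0 < r n := fun n => by positivity
  have hstep : ∀ (F : {F : Submodule ℝ X // FiniteDimensional ℝ F}) (n : ℕ), ∃ V : X →L[ℝ] X,
      FiniteDimensional ℝ V.toLinearMap.range ∧ (∀ x ∈ F.1, V x = x) ∧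
      ‖1 - (2 : ℝ) • V‖ ≤ Real.exp (r n) := fun F n => by
    have := F.2
    obtain ⟨V, hV1, hV2, hV3⟩ := exists_perturbation (J := ContinuousLinearMap.id ℝ X) hT hT1 F.1
    have h1 : Tendsto (fun n => ‖ContinuousLinearMap.id ℝ X - (2 : ℝ) • T n‖ + 2 * ‖V n - T n‖)
        atTop (𝓝 1) := by simpa using hT2.add (hV3.const_mul 2)
    obtain ⟨m, hm⟩ := (h1.eventually_lt_const (Real.one_lt_exp_iff.2 (hr n))).exists
    refine ⟨V m, hV1 m, hV2 m, le_trans ?_ hm.le⟩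
    have h2 : (1 : X →L[ℝ] X) - (2 : ℝ) • V m =
        (ContinuousLinearMap.id ℝ X - (2 : ℝ) • T m) - (2 : ℝ) • (V m - T m) := by
      rw [smul_sub, ContinuousLinearMap.one_def]; abel
    rw [h2]
    refine (norm_sub_le _ _).trans (le_of_eq ?_)
    rw [norm_smul (2 : ℝ) (V m - T m)]; simp
  choose V hV1 hV2 hV3 using hstep
  let F : ℕ → {F : Submodule ℝ X // FiniteDimensional ℝ F} := fun n =>
    Nat.rec ⟨⊥, inferInstance⟩ (fun n F => ⟨F.1 ⊔ Submodule.span ℝ {d n} ⊔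
      (V F n).toLinearMap.range, by
        have := F.2
        have := hV1 F n
        infer_instance⟩) n
  have hF : ∀ n, (F (n + 1)).1 = (F n).1 ⊔ Submodule.span ℝ {d n} ⊔
      (V (F n) n).toLinearMap.range := fun _ => rfl
  have hFmono : Monotone fun n => (F n).1 := monotone_nat_of_le_succ fun n => by
    rw [hF]; exact le_sup_of_le_left le_sup_left
  let B : ℕ → X →L[ℝ] X := fun n => Nat.casesOn n 0 fun n => V (F n) n
  have hBB : ∀ n k, k ≤ n → B (n + 1) * B k = B k := fun n k hk => by
    cases k with
    | zero => exact mul_zero _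
    | succ k =>
      ext x
      refine hV2 (F n) n _ (hFmono hk ?_)
      change B (k + 1) x ∈ (F (k + 1)).1
      rw [hF]
      exact Submodule.mem_sup_right ⟨x, rfl⟩
  have key : ∀ n (e : ℕ → ℝ), (∀ j, e j = 0 ∨ e j = 1) →
      ‖1 - (2 : ℝ) • ∑ j ∈ Finset.range n, e j • (B (j + 1) - B j)‖ ≤
        Real.exp (∑ j ∈ Finset.range n, r j) := fun n => by
    induction n with
    | zero =>
      intro e _
      rw [Finset.sum_range_zero, Finset.sum_range_zero, smul_zero, sub_zero, Real.exp_zero]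
      exact ContinuousLinearMap.norm_id_le
    | succ n ih =>
      intro e he
      rcases he n with h | h
      · rw [Finset.sum_range_succ, h, zero_smul, add_zero]
        refine (ih e he).trans (Real.exp_le_exp.2 ?_)
        rw [Finset.sum_range_succ]
        linarith [hr n]
      · -- if the last difference occurs, apply the induction hypothesis to the complement
        set N := ∑ j ∈ Finset.range n, (1 - e j) • (B (j + 1) - B j) with hN
        have h1 : ∑ j ∈ Finset.range (n + 1), e j • (B (j + 1) - B j) = B (n + 1) - N := by
          have h2 : ∑ j ∈ Finset.range n, e j • (B (j + 1) - B j) + N = B n := by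
            rw [hN, ← Finset.sum_add_distrib]
            have : ∀ j ∈ Finset.range n, e j • (B (j + 1) - B j) +
                (1 - e j) • (B (j + 1) - B j) = B (j + 1) - B j := fun j _ => by
              rw [← add_smul, add_sub_cancel, one_smul]
            rw [Finset.sum_congr rfl this, Finset.sum_range_sub]
            exact sub_zero _
          rw [Finset.sum_range_succ, h, one_smul, ← h2]
          abel
        have h3 : B (n + 1) * N = N := by
          rw [hN, Finset.mul_sum]
          refine Finset.sum_congr rfl fun j hj => ?_
          have := Finset.mem_range.1 hj
          rw [mul_smul_comm, mul_sub, hBB n (j + 1) this, hBB n j this.le]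
        have h4 : (1 : X →L[ℝ] X) - (2 : ℝ) • (B (n + 1) - N) =
            (1 - (2 : ℝ) • B (n + 1)) * (1 - (2 : ℝ) • N) := by
          rw [mul_sub, mul_one, sub_mul, one_mul, smul_mul_smul_comm, h3]
          module
        rw [h1, h4, Finset.sum_range_succ, Real.exp_add, mul_comm (Real.exp _)]
        refine (norm_mul_le _ _).trans (mul_le_mul (hV3 (F n) n) (ih _ fun j => ?_)
          (norm_nonneg _) (Real.exp_nonneg _))
        rcases he j with h | h <;> simp [h]
  have hexp : ∀ n, Real.exp (∑ j ∈ Finset.range n, r j) ≤ 1 + δ := fun n => by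
    rw [← Real.le_log_iff_exp_le (by linarith)]
    exact sum_geometric_bound hlog.le n
  refine ⟨_, isFinitaryExpansion_of_partialSums (V := B) hd rfl (fun n => ?_)
    (fun i n hin => ?_) fun ε hε n => ?_⟩
  · cases n with
    | zero => exact finiteDimensional_range_zero
    | succ n => exact hV1 _ _
  · refine hV2 (F n) n _ (hFmono hin ?_)
    change d i ∈ (F (i + 1)).1
    rw [hF]
    exact Submodule.mem_sup_left (Submodule.mem_sup_right (Submodule.mem_span_singleton_self _))
  · -- a signed sum is half the difference of two operators as in `key`
    have h1 : ∑ j ∈ Finset.range n, ε j • (B (j + 1) - B j) =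
        (1 / 2 : ℝ) • ((1 - (2 : ℝ) • ∑ j ∈ Finset.range n, ((1 - ε j) / 2) • (B (j + 1) - B j)) -
          (1 - (2 : ℝ) • ∑ j ∈ Finset.range n, ((1 + ε j) / 2) • (B (j + 1) - B j))) := by
      rw [sub_sub_sub_cancel_left, ← smul_sub, ← Finset.sum_sub_distrib, smul_smul,
        Finset.smul_sum]
      refine Finset.sum_congr rfl fun j _ => ?_
      rw [← sub_smul, smul_smul]
      congr 1
      ring
    have h2 := (key n (fun j => (1 - ε j) / 2) fun j => by
      rcases hε j with h | h <;> norm_num [h]).trans (hexp n)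
    have h3 := (key n (fun j => (1 + ε j) / 2) fun j => by
      rcases hε j with h | h <;> norm_num [h]).trans (hexp n)
    rw [h1, norm_smul]
    have h4 := norm_sub_le
      (1 - (2 : ℝ) • ∑ j ∈ Finset.range n, ((1 - ε j) / 2) • (B (j + 1) - B j))
      (1 - (2 : ℝ) • ∑ j ∈ Finset.range n, ((1 + ε j) / 2) • (B (j + 1) - B j))
    have h5 : ‖(1 / 2 : ℝ)‖ = 1 / 2 := by norm_num
    rw [h5]
    linarith

end Expansions

/-! ### Reflexivity, nets and the Banach-Mazur distance -/

section Auxiliary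

variable {X : Type*} [NormedAddCommGroup X] [NormedSpace ℝ X]
variable {Y : Type*} [NormedAddCommGroup Y] [NormedSpace ℝ Y]

theorem isReflexiveSpace_of_innerProductSpace {H : Type*} [NormedAddCommGroup H]
    [InnerProductSpace ℝ H] [CompleteSpace H] : IsReflexiveSpace H := by
  intro φ
  let ψ : StrongDual ℝ H := LinearMap.mkContinuous
    { toFun := fun x => φ (InnerProductSpace.toDual ℝ H x)
      map_add' := fun x y => by rw [map_add, map_add]
      map_smul' := fun c x => by simp } ‖φ‖
    (fun x => (φ.le_opNorm _).trans (by simp))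
  refine ⟨(InnerProductSpace.toDual ℝ H).symm ψ, ?_⟩
  ext f
  rw [NormedSpace.dual_def]
  obtain ⟨y, rfl⟩ := (InnerProductSpace.toDual ℝ H).surjective f
  rw [InnerProductSpace.toDual_apply_apply, real_inner_comm, InnerProductSpace.toDual_symm_apply]
  rfl

theorem IsReflexiveSpace.prod (hX : IsReflexiveSpace X) (hY : IsReflexiveSpace Y) :
    IsReflexiveSpace (X × Y) := by
  intro φ
  obtain ⟨x, hx⟩ := hX (φ.comp ((ContinuousLinearMap.compL ℝ (X × Y) X ℝ).flip
    (ContinuousLinearMap.fst ℝ X Y)))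
  obtain ⟨y, hy⟩ := hY (φ.comp ((ContinuousLinearMap.compL ℝ (X × Y) Y ℝ).flip
    (ContinuousLinearMap.snd ℝ X Y)))
  refine ⟨(x, y), ?_⟩
  ext f
  have h1 := DFunLike.congr_fun hx (f.comp (ContinuousLinearMap.inl ℝ X Y))
  have h2 := DFunLike.congr_fun hy (f.comp (ContinuousLinearMap.inr ℝ X Y))
  rw [NormedSpace.dual_def] at h1 h2 ⊢
  have h3 : f = (f.comp (ContinuousLinearMap.inl ℝ X Y)).comp (ContinuousLinearMap.fst ℝ X Y) +
      (f.comp (ContinuousLinearMap.inr ℝ X Y)).comp (ContinuousLinearMap.snd ℝ X Y) := by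
    ext <;> simp [← Prod.zero_eq_mk]
  have h4 : f (x, y) = f (x, 0) + f (0, y) := by rw [← map_add]; simp
  calc f (x, y) = f (x, 0) + f (0, y) := h4
    _ = _ := congrArg₂ (· + ·) h1 h2
    _ = φ _ := (map_add φ _ _).symm
    _ = φ f := congrArg φ h3.symm

theorem totallyBounded_image_dual_ball_of_finiteDimensional [FiniteDimensional ℝ Y]
    (A : X →L[ℝ] Y) :
    TotallyBounded {g : StrongDual ℝ X | ∃ f : StrongDual ℝ Y, ‖f‖ ≤ 1 ∧ f.comp A = g} := by
  have : ProperSpace (StrongDual ℝ Y) := FiniteDimensional.proper ℝ (StrongDual ℝ Y)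
  refine (((isCompact_closedBall (0 : StrongDual ℝ Y) 1).image
    ((ContinuousLinearMap.compL ℝ X Y ℝ).flip A).continuous).totallyBounded).subset ?_
  rintro _ ⟨f, hf, rfl⟩
  exact ⟨f, mem_closedBall_zero_iff.2 hf, rfl⟩

theorem totallyBounded_image_dual_ball (A : X →L[ℝ] Y)
    (hA : FiniteDimensional ℝ A.toLinearMap.range) :
    TotallyBounded {g : StrongDual ℝ X | ∃ f : StrongDual ℝ Y, ‖f‖ ≤ 1 ∧ f.comp A = g} := by
  refine (totallyBounded_image_dual_ball_of_finiteDimensional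
    (A.codRestrict A.toLinearMap.range (fun x => ⟨x, rfl⟩))).subset ?_
  rintro _ ⟨f, hf, rfl⟩
  refine ⟨f.comp (Submodule.subtypeL _), ?_, rfl⟩
  refine ContinuousLinearMap.opNorm_le_bound _ zero_le_one fun y => ?_
  exact f.le_of_opNorm_le hf (y : Y)

/-- An enumeration `i ↦ (j i, g i)` of the pairs `(n, s)` with `s ∈ S n`, for a sequence of finite
nonempty sets `S n`. -/
theorem exists_enumeration {α : Type*} {S : ℕ → Set α} (hS : ∀ n, (S n).Finite)
    (hne : ∀ n, (S n).Nonempty) : ∃ (j : ℕ → ℕ) (g : ℕ → α), (∀ i, g i ∈ S (j i)) ∧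
      (∀ n, ∀ s ∈ S n, ∃ i, j i = n ∧ g i = s) ∧ (∀ i k, j i = j k → g i = g k → i = k) ∧
      Tendsto j atTop atTop := by
  let I := {p : ℕ × α // p.2 ∈ S p.1}
  have hfib : ∀ N, {p : I | p.1.1 < N}.Finite := fun N => by
    refine Set.Finite.of_finite_image (f := Subtype.val) ?_ Subtype.val_injective.injOn
    refine ((Set.finite_Iio N).biUnion fun n _ => (Set.finite_singleton n).prod (hS n)).subset ?_
    rintro _ ⟨p, hp, rfl⟩
    exact Set.mem_biUnion (Set.mem_Iio.2 hp) ⟨rfl, p.2⟩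
  have hcount : Countable I := by
    rw [← Set.countable_univ_iff]
    refine (Set.countable_iUnion fun N => (hfib N).countable).mono fun p _ => ?_
    exact Set.mem_iUnion.2 ⟨p.1.1 + 1, Nat.lt_succ_self _⟩
  choose s hs using hne
  have hinf : Infinite I := Infinite.of_injective (fun n => (⟨(n, s n), hs n⟩ : I))
    fun m n h => congrArg (fun p : I => p.1.1) h
  obtain ⟨e⟩ : Nonempty (ℕ ≃ I) := nonempty_equiv_of_countable
  refine ⟨fun i => (e i).1.1, fun i => (e i).1.2, fun i => (e i).2, fun n s hs => ?_,
    fun i k h1 h2 => e.injective (Subtype.ext (Prod.ext h1 h2)), ?_⟩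
  · exact ⟨e.symm ⟨(n, s), hs⟩, by simp, by simp⟩
  · refine tendsto_atTop.2 fun N => ?_
    rw [← Nat.cofinite_eq_atTop, Filter.eventually_cofinite]
    refine ((hfib N).preimage (f := e) e.injective.injOn).subset fun i hi => ?_
    exact not_le.1 hi

theorem banachMazurDist_range_le (T : X →L[ℝ] Y) {a b : ℝ} (ha : 0 ≤ a) (hb : 0 ≤ b)
    (hT : ∀ x, ‖T x‖ ≤ a * ‖x‖) (hT' : ∀ x, ‖x‖ ≤ b * ‖T x‖) :
    banachMazurDist X T.toLinearMap.range ≤ ENNReal.ofReal (a * b) := by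
  have hinj : Function.Injective T.toLinearMap := by
    rw [injective_iff_map_eq_zero]
    intro x hx
    have h := hT' x
    rw [show T x = 0 from hx, norm_zero, mul_zero] at h
    exact norm_le_zero_iff.1 h
  let e : X ≃ₗ[ℝ] T.toLinearMap.range := LinearEquiv.ofInjective T.toLinearMap hinj
  have he : ∀ x, ‖e x‖ ≤ a * ‖x‖ := hT
  have he' : ∀ y, ‖e.symm y‖ ≤ b * ‖y‖ := fun y => by
    obtain ⟨x, rfl⟩ := e.surjective y
    rw [e.symm_apply_apply]
    exact hT' x
  let E : X ≃L[ℝ] T.toLinearMap.range :=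
    { e with
      continuous_toFun := (e.toLinearMap.mkContinuous a he).continuous
      continuous_invFun := (e.symm.toLinearMap.mkContinuous b he').continuous }
  refine (iInf_le _ E).trans ?_
  rw [ENNReal.ofReal_mul ha]
  refine mul_le_mul' ?_ ?_
  · rw [← ofReal_norm]
    exact ENNReal.ofReal_le_ofReal (ContinuousLinearMap.opNorm_le_bound _ ha he)
  · rw [← ofReal_norm]
    exact ENNReal.ofReal_le_ofReal (ContinuousLinearMap.opNorm_le_bound _ hb he')

end Auxiliary

/-! ### The embedding into the dual of the space of series -/

namespace WUCSeries

variable {X : Type*} [NormedAddCommGroup X] [NormedSpace ℝ X]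
variable {G : ℕ → Submodule ℝ (StrongDual ℝ X)}

theorem summable_abs_coord (v : WUCSeries G) (x : X) : Summable fun j => |coord j v x| :=
  summable_of_sum_le (fun _ => abs_nonneg _) fun F => sum_abs_coord_le v F x

variable (G) in
/-- The functional `v ↦ ∑ g_j x` on the space of series `v = ∑ g_j`. -/
noncomputable def sumEval : X →L[ℝ] StrongDual ℝ (WUCSeries G) :=
  LinearMap.mkContinuous₂
    (LinearMap.mk₂ ℝ (fun x (v : WUCSeries G) => ∑' j, coord j v x)
      (fun x y v => by
        rw [← (summable_abs_coord v x).of_abs.tsum_add (summable_abs_coord v y).of_abs]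
        exact tsum_congr fun j => map_add _ _ _)
      (fun c x v => by
        rw [smul_eq_mul, ← tsum_mul_left]
        exact tsum_congr fun j => map_smul _ _ _)
      (fun x v w => by
        rw [← (summable_abs_coord v x).of_abs.tsum_add (summable_abs_coord w x).of_abs]
        exact tsum_congr fun j => by rw [map_add, _root_.add_apply])
      (fun c x v => by
        rw [smul_eq_mul, ← tsum_mul_left]
        exact tsum_congr fun j => by rw [map_smul, _root_.smul_apply, smul_eq_mul])) 1
    (fun x v => by
      rw [one_mul, mul_comm]
      have h := abs_tsum_mul_le (e := fun _ => 1) (by simp) fun F => sum_abs_coord_le v F x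
      simpa using h)

theorem sumEval_apply (x : X) (v : WUCSeries G) : sumEval G x v = ∑' j, coord j v x := rfl

theorem norm_sumEval_le (x : X) : ‖sumEval G x‖ ≤ ‖x‖ := by
  refine ContinuousLinearMap.opNorm_le_bound _ (norm_nonneg _) fun v => ?_
  rw [mul_comm, sumEval_apply]
  have h := abs_tsum_mul_le (e := fun _ => 1) (by simp) fun F => sum_abs_coord_le v F x
  simpa using h

/-- The series with a single nonzero term `g` at the position `i`. -/
noncomputable def single (i : ℕ) : G i →ₗ[ℝ] WUCSeries G where
  toFun g := mk (Function.update 0 i (g : StrongDual ℝ X))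
    (fun j => by
      by_cases h : j = i
      · subst h; simp
      · rw [Function.update_of_ne h]; exact (G j).zero_mem) ‖(g : StrongDual ℝ X)‖
    (fun F x => by
      have h1 : ∀ j ∈ F, j ≠ i →
          |(Function.update 0 i (g : StrongDual ℝ X) : ℕ → StrongDual ℝ X) j x| = 0 :=
        fun j _ hj => by rw [Function.update_of_ne hj]; simp
      by_cases hi : i ∈ F
      · rw [Finset.sum_eq_single_of_mem i hi h1, Function.update_self]
        exact (g : StrongDual ℝ X).le_opNorm x
      · rw [Finset.sum_eq_zero fun j hj => h1 j hj fun h => hi (h ▸ hj)]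
        positivity)
  map_add' g h := ext_coord fun j => by
    rw [map_add, coord_mk, coord_mk, coord_mk]
    by_cases h : j = i
    · subst h; simp
    · simp [Function.update_of_ne h]
  map_smul' c g := ext_coord fun j => by
    rw [map_smul, coord_mk, coord_mk]
    by_cases h : j = i
    · subst h; simp
    · simp [Function.update_of_ne h]

theorem coord_single (i j : ℕ) (g : G i) :
    coord j (single i g) = if j = i then (g : StrongDual ℝ X) else 0 := by
  change Function.update (0 : ℕ → StrongDual ℝ X) i (g : StrongDual ℝ X) j = _
  rw [Function.update_apply]
  rfl

theorem proj_eq_single (i : ℕ) (v : WUCSeries G) :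
    proj i v = single i ⟨coord i v, coord_mem i v⟩ :=
  ext_coord fun j => by
    rw [coord_proj, coord_single]
    split_ifs with h
    · rw [h]
    · rfl

theorem sumEval_mem_dualPart (hX : DualWUCNull X) (hG : ∀ j, FiniteDimensional ℝ (G j))
    (hd : Dense {x : X | ∀ᶠ j in atTop, ∀ g ∈ G j, g x = 0}) (x : X) :
    sumEval G x ∈ dualPart (proj : ℕ → WUCSeries G →L[ℝ] WUCSeries G) := by
  have hclosed := (isBoundedlyCompleteUFDD_proj hX hG).isClosed_dualPart.preimage
    (sumEval G).continuous
  refine hclosed.closure_subset_iff.2 (fun y hy => ?_) (hd x)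
  rw [Set.mem_preimage, SetLike.mem_coe, mem_dualPart]
  obtain ⟨N, hN⟩ := eventually_atTop.1 hy
  refine tendsto_const_nhds.congr' ?_
  filter_upwards [eventually_ge_atTop N] with n hn
  ext v
  rw [ContinuousLinearMap.comp_apply, sumEval_apply, sumEval_apply, _root_.sum_apply]
  refine tsum_congr fun j => ?_
  rw [coord_sum_proj]
  split_ifs with h
  · rfl
  · rw [hN j (hn.trans (not_lt.1 h)) _ (coord_mem j v)]; rfl

variable (G) in
/-- The predual of the space of series, as a space of functionals on it. -/
abbrev Predual : Type _ := DualPart (proj : ℕ → WUCSeries G →L[ℝ] WUCSeries G)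

/-- The contraction from `X` to the predual of the space of series given by `sumEval`. -/
noncomputable def embedding (hX : DualWUCNull X) (hG : ∀ j, FiniteDimensional ℝ (G j))
    (hd : Dense {x : X | ∀ᶠ j in atTop, ∀ g ∈ G j, g x = 0}) :
    X →L[ℝ] Predual G :=
  LinearMap.mkContinuous
    { toFun := fun x => .mk (sumEval G x) (sumEval_mem_dualPart hX hG hd x)
      map_add' := fun x y => DualPart.ext (map_add (sumEval G) x y)
      map_smul' := fun c x => DualPart.ext (map_smul (sumEval G) c x) } 1
    (fun x => by
      rw [one_mul]
      exact norm_sumEval_le x)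

theorem norm_embedding_le (hX : DualWUCNull X) (hG : ∀ j, FiniteDimensional ℝ (G j)) (hd) (x : X) :
    ‖embedding hX hG hd x‖ ≤ ‖x‖ := norm_sumEval_le x

end WUCSeries

/-! ### Complemented subspaces of spaces with a shrinking unconditional decomposition -/

section Complemented

variable {X : Type*} [NormedAddCommGroup X] [NormedSpace ℝ X]
variable {Y : Type*} [NormedAddCommGroup Y] [NormedSpace ℝ Y]

theorem IsFinitaryExpansion.nonneg {J : X →L[ℝ] Y} {c : ℝ} {A : ℕ → X →L[ℝ] Y}
    (hA : IsFinitaryExpansion J c A) : 0 ≤ c :=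
  (norm_nonneg _).trans (hA.norm_signed_sum_le (fun _ => 1) (fun _ => Or.inl rfl) 0)

theorem IsFinitaryExpansion.sum_abs_le {J : X →L[ℝ] Y} {c : ℝ} {A : ℕ → X →L[ℝ] Y}
    (hA : IsFinitaryExpansion J c A) (f : StrongDual ℝ Y) (F : Finset ℕ) (x : X) :
    ∑ j ∈ F, |f (A j x)| ≤ c * ‖f‖ * ‖x‖ := by
  let ε : ℕ → ℝ := fun j => if 0 ≤ f (A j x) then 1 else -1
  have hε : ∀ j, ε j = 1 ∨ ε j = -1 := fun j => by
    simp only [ε]; split_ifs <;> simp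
  have h1 : ∀ j, |f (A j x)| = ε j * f (A j x) := fun j => by
    simp only [ε]
    split_ifs with h
    · rw [abs_of_nonneg h, one_mul]
    · rw [abs_of_neg (not_le.1 h)]; ring
  have h2 : F ⊆ Finset.range (F.sup id + 1) := fun j hj =>
    Finset.mem_range.2 (Nat.lt_succ_of_le (Finset.le_sup (f := id) hj))
  refine (Finset.sum_le_sum_of_subset_of_nonneg h2 fun _ _ _ => abs_nonneg _).trans ?_
  have h3 : ∑ j ∈ Finset.range (F.sup id + 1), |f (A j x)| =
      f ((∑ j ∈ Finset.range (F.sup id + 1), ε j • A j) x) := by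
    rw [_root_.sum_apply, map_sum]
    refine Finset.sum_congr rfl fun j _ => ?_
    rw [h1, _root_.smul_apply, map_smul, smul_eq_mul]
  rw [h3]
  refine (Real.le_norm_self _).trans ((f.le_opNorm _).trans ?_)
  rw [mul_comm c, mul_assoc]
  exact mul_le_mul_of_nonneg_left ((∑ j ∈ Finset.range (F.sup id + 1), ε j • A j).le_of_opNorm_le
    (hA.norm_signed_sum_le ε hε _) x) (norm_nonneg _)

theorem IsFinitaryExpansion.hasSum {J : X →L[ℝ] Y} {c : ℝ} {A : ℕ → X →L[ℝ] Y}
    (hA : IsFinitaryExpansion J c A) (f : StrongDual ℝ Y) (x : X) :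
    HasSum (fun j => f (A j x)) (f (J x)) := by
  have hs : Summable fun j => f (A j x) :=
    (summable_of_sum_le (fun _ => abs_nonneg _) fun F => hA.sum_abs_le f F x).of_abs
  have h := (f.continuous.tendsto _).comp (hA.tendsto_sum x)
  simp only [Function.comp_def, map_sum] at h
  exact tendsto_nhds_unique hs.hasSum.tendsto_sum_nat h ▸ hs.hasSum

theorem IsFinitaryExpansion.dense_adjointRange {J : X →L[ℝ] Y} {c : ℝ} {A : ℕ → X →L[ℝ] Y}
    (hA : IsFinitaryExpansion J c A) :
    Dense {x : X | ∀ᶠ j in atTop, ∀ g ∈ adjointRange (A j), g x = 0} := by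
  refine hA.dense.mono fun x hx => ?_
  filter_upwards [hx] with j hj
  rintro _ ⟨f, rfl⟩
  change f (A j x) = 0
  rw [hj, map_zero]

/-- The operator `f ↦ (f ∘ A_j)_j` from the dual of `Y` to the space of series. -/
noncomputable def IsFinitaryExpansion.toSeries {J : X →L[ℝ] Y} {c : ℝ} {A : ℕ → X →L[ℝ] Y}
    (hA : IsFinitaryExpansion J c A) :
    StrongDual ℝ Y →L[ℝ] WUCSeries fun j => adjointRange (A j) :=
  LinearMap.mkContinuous
    { toFun := fun f => .mk (fun j => f.comp (A j)) (fun _ => ⟨f, rfl⟩) (c * ‖f‖) (hA.sum_abs_le f)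
      map_add' := fun f g => WUCSeries.ext_coord fun j => by
        rw [map_add]; rfl
      map_smul' := fun a f => WUCSeries.ext_coord fun j => by
        rw [map_smul]; rfl } c
    (fun f => WUCSeries.norm_mk_le _ _ (mul_nonneg hA.nonneg (norm_nonneg _)) _)

theorem IsFinitaryExpansion.norm_toSeries_le {J : X →L[ℝ] Y} {c : ℝ} {A : ℕ → X →L[ℝ] Y}
    (hA : IsFinitaryExpansion J c A) (f : StrongDual ℝ Y) : ‖hA.toSeries f‖ ≤ c * ‖f‖ :=
  WUCSeries.norm_mk_le _ _ (mul_nonneg hA.nonneg (norm_nonneg _)) _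

/-- The adjoint of `toSeries` maps the predual of the space of series to `Y` (inside the bidual):
this holds for the members of the adjoint ranges of the projections, since functionals on the
finite-dimensional spaces `adjointRange (A j)` are evaluations, and extends to limits. -/
theorem IsFinitaryExpansion.exists_sum [CompleteSpace Y] {J : X →L[ℝ] Y} {c : ℝ}
    {A : ℕ → X →L[ℝ] Y} (hA : IsFinitaryExpansion J c A) (hX : DualWUCNull X)
    (z : WUCSeries.Predual fun j => adjointRange (A j)) :
    ∃ y : Y, ∀ f, f y = z.val (hA.toSeries f) := by
  have hG : ∀ j, FiniteDimensional ℝ (adjointRange (A j)) := fun j =>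
    have := hA.finiteRank j
    finiteDimensional_adjointRange (A j)
  have hq := WUCSeries.isBoundedlyCompleteUFDD_proj (G := fun j => adjointRange (A j)) hX hG
  have h1 : ∀ j, ∃ y : Y, ∀ f, f y = z.val (WUCSeries.proj j (hA.toSeries f)) := fun j => by
    have := hG j
    obtain ⟨x, hx⟩ := exists_eval_eq_of_finiteDimensional (adjointRange (A j))
      (z.val.toLinearMap.comp
        (WUCSeries.single (G := fun j => adjointRange (A j)) j))
    refine ⟨A j x, fun f => ?_⟩
    rw [WUCSeries.proj_eq_single]
    exact (hx ⟨f.comp (A j), f, rfl⟩).symm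
  choose y hy using h1
  have h2 : ∀ m n f, f (∑ j ∈ Finset.range m, y j - ∑ j ∈ Finset.range n, y j) =
      (∑ j ∈ Finset.range m, dualProj hq.toIsFDD j z -
        ∑ j ∈ Finset.range n, dualProj hq.toIsFDD j z).val (hA.toSeries f) := fun m n f => by
    rw [← DualPart.valL_apply, map_sub, map_sub, DualPart.valL_apply, DualPart.valL_apply,
      coe_sum_dualProj, coe_sum_dualProj]
    simp [hy, _root_.sum_apply]
  have h3 : ∀ m n, dist (∑ j ∈ Finset.range m, y j) (∑ j ∈ Finset.range n, y j) ≤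
      c * dist (∑ j ∈ Finset.range m, dualProj hq.toIsFDD j z)
        (∑ j ∈ Finset.range n, dualProj hq.toIsFDD j z) := fun m n => by
    rw [dist_eq_norm, dist_eq_norm]
    refine NormedSpace.norm_le_dual_bound ℝ _ (mul_nonneg hA.nonneg (norm_nonneg _)) fun f => ?_
    rw [h2]
    refine (ContinuousLinearMap.le_opNorm _ _).trans ?_
    rw [DualPart.norm_val, mul_comm c, mul_assoc]
    exact mul_le_mul_of_nonneg_left (hA.norm_toSeries_le f) (norm_nonneg _)
  have hlim := hq.isOneUFDD_dualProj.tendsto_sum z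
  have hc := Metric.cauchySeq_iff.1 hlim.cauchySeq
  have hcauchy : CauchySeq fun n => ∑ j ∈ Finset.range n, y j := by
    rw [Metric.cauchySeq_iff]
    intro η hη
    have hpos : 0 < c + 1 := by linarith [hA.nonneg]
    obtain ⟨N, hN⟩ := hc (η / (c + 1)) (div_pos hη hpos)
    refine ⟨N, fun m hm n hn => (h3 m n).trans_lt ?_⟩
    have h4 := hN m hm n hn
    rw [lt_div_iff₀ hpos] at h4
    have h5 := dist_nonneg (x := ∑ j ∈ Finset.range m, dualProj hq.toIsFDD j z)
      (y := ∑ j ∈ Finset.range n, dualProj hq.toIsFDD j z)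
    nlinarith
  obtain ⟨w, hw⟩ := cauchySeq_tendsto_of_complete hcauchy
  refine ⟨w, fun f => ?_⟩
  have t1 := (f.continuous.tendsto w).comp hw
  have t2 := (((NormedSpace.inclusionInDoubleDual ℝ _ (hA.toSeries f)).comp
    (DualPart.valL _).toContinuousLinearMap).continuous.tendsto z).comp hlim
  refine tendsto_nhds_unique t1 (t2.congr fun n => ?_)
  have h6 := h2 n 0 f
  simp only [Finset.range_zero, Finset.sum_empty, sub_zero] at h6
  exact h6.symm

theorem IsFinitaryExpansion.exists_projection [CompleteSpace Y] {J : X →L[ℝ] Y} {c : ℝ}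
    {A : ℕ → X →L[ℝ] Y} (hA : IsFinitaryExpansion J c A) (hX : DualWUCNull X) :
    ∃ P : WUCSeries.Predual (fun j => adjointRange (A j)) →L[ℝ] Y,
      (∀ z (f : StrongDual ℝ Y), f (P z) = z.val (hA.toSeries f)) ∧ ∀ z, ‖P z‖ ≤ c * ‖z‖ := by
  choose P hP using hA.exists_sum hX
  have hn : ∀ z, ‖P z‖ ≤ c * ‖z‖ := fun z => by
    refine NormedSpace.norm_le_dual_bound ℝ _ (mul_nonneg hA.nonneg (norm_nonneg _)) fun f => ?_
    rw [hP]
    refine (ContinuousLinearMap.le_opNorm _ _).trans ?_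
    rw [DualPart.norm_val, mul_comm c, mul_assoc]
    exact mul_le_mul_of_nonneg_left (hA.norm_toSeries_le f) (norm_nonneg _)
  refine ⟨LinearMap.mkContinuous
    { toFun := P
      map_add' := fun z w => ?_
      map_smul' := fun a z => ?_ } c hn, hP, hn⟩
  · refine (SeparatingDual.eq_iff_forall_dual_eq (R := ℝ)).2 fun f => ?_
    rw [map_add, hP, hP, hP]; rfl
  · refine (SeparatingDual.eq_iff_forall_dual_eq (R := ℝ)).2 fun f => ?_
    rw [map_smul, hP, hP]; rfl

end Complemented

theorem IsFinitaryExpansion.exists_complemented {X : Type u} [NormedAddCommGroup X]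
    [NormedSpace ℝ X] [CompleteSpace X] (hX : DualWUCNull X) {c : ℝ} {A : ℕ → X →L[ℝ] X}
    (hA : IsFinitaryExpansion (ContinuousLinearMap.id ℝ X) c A) :
    ∃ (Z : Type u) (_ : NormedAddCommGroup Z) (_ : NormedSpace ℝ Z) (_ : CompleteSpace Z)
      (Q : ℕ → Z →L[ℝ] Z) (W : Submodule ℝ Z),
      (IsReflexiveSpace X → IsReflexiveSpace Z) ∧ IsOneUFDD Q ∧ IsShrinkingFDD Q ∧
      W.IsComplementedWith c ∧ banachMazurDist X W ≤ ENNReal.ofReal c := by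
  have hG : ∀ j, FiniteDimensional ℝ (adjointRange (A j)) := fun j =>
    have := hA.finiteRank j
    finiteDimensional_adjointRange (A j)
  have hq := WUCSeries.isBoundedlyCompleteUFDD_proj (G := fun j => adjointRange (A j)) hX hG
  let T := WUCSeries.embedding hX hG hA.dense_adjointRange
  have hT : ∀ x, ‖T x‖ ≤ ‖x‖ := WUCSeries.norm_embedding_le hX hG hA.dense_adjointRange
  obtain ⟨P, hP, hPn⟩ := hA.exists_projection hX
  have hPT : ∀ x, P (T x) = x := fun x => by
    refine (SeparatingDual.eq_iff_forall_dual_eq (R := ℝ)).2 fun f => ?_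
    rw [hP]
    exact (hA.hasSum f x).tsum_eq
  refine ⟨DualPart WUCSeries.proj, inferInstance, inferInstance, hq.completeSpace_dualPart,
    dualProj hq.toIsFDD, T.toLinearMap.range, fun hr => ?_, hq.isOneUFDD_dualProj,
    hq.isShrinkingFDD_dualProj, ⟨(T.comp P).codRestrict _ (fun z => ⟨_, rfl⟩), ?_, ?_⟩, ?_⟩
  · exact hq.isReflexiveSpace_dualPart
      (WUCSeries.mem_dualPart_of_isReflexiveSpace hX hr hA.dense_adjointRange)
  · rintro ⟨_, x, rfl⟩
    exact Subtype.ext (congrArg T (hPT x))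
  · refine ContinuousLinearMap.opNorm_le_bound _ hA.nonneg fun z => ?_
    exact (hT _).trans (hPn z)
  · have h := banachMazurDist_range_le T zero_le_one hA.nonneg (fun x => by simpa using hT x)
      (fun x => by simpa [hPT] using hPn (T x))
    simpa using h

/-! ### Unconditional bases from one-dimensional decompositions -/

section Basis

variable {Z : Type*} [NormedAddCommGroup Z] [NormedSpace ℝ Z]

/-- The Schauder basis of vectors `b j` with `Q j = f j ⊗ b j` for a decomposition `Q` into lines. -/
noncomputable def IsFDD.schauderBasis {Q : ℕ → Z →L[ℝ] Z} (hQ : IsFDD Q) (b : ℕ → Z)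
    (f : ℕ → StrongDual ℝ Z) (hf : ∀ i j, f i (b j) = if i = j then 1 else 0)
    (hQf : ∀ j z, Q j z = f j z • b j) : SchauderBasis ℝ Z where
  basis := b
  coord := f
  ortho i j := by by_cases h : i = j <;> simp [hf, h]
  expansion z := by
    rw [HasSum, SummationFilter.conditional_filter_eq_map_range, tendsto_map'_iff]
    simp only [← hQf]
    exact hQ.tendsto_sum z

variable {Q : ℕ → Z →L[ℝ] Z} {b : ℕ → Z} {f : ℕ → StrongDual ℝ Z}

theorem IsOneUFDD.isOneUnconditional_schauderBasis (hQ : IsOneUFDD Q) (hf) (hQf) :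
    (hQ.toIsFDD.schauderBasis b f hf hQf).IsOneUnconditional := by
  intro ε hε a n
  change ‖∑ j ∈ Finset.range n, ε j • a j • b j‖ ≤ ‖∑ j ∈ Finset.range n, a j • b j‖
  have h1 : ∀ j ∈ Finset.range n, Q j (∑ k ∈ Finset.range n, a k • b k) = a j • b j :=
    fun j hj => by
      rw [hQf, map_sum, Finset.sum_eq_single_of_mem j hj]
      · rw [map_smul, hf, if_pos rfl, smul_eq_mul, mul_one]
      · intro k _ hk
        rw [map_smul, hf, if_neg hk.symm, smul_zero]
  have h2 := hQ.norm_signed_sum_le ε hε (∑ k ∈ Finset.range n, a k • b k) n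
  rwa [Finset.sum_congr rfl h1, Finset.sum_congr rfl fun j hj => by rw [h1 j hj]] at h2

theorem IsShrinkingFDD.isShrinkingBasis_schauderBasis (hQ : IsFDD Q) (hs : IsShrinkingFDD Q)
    (hf) (hQf) : (hQ.schauderBasis b f hf hQf).IsShrinkingBasis := by
  intro g
  have h : ∀ n, SchauderBasis.proj (hQ.schauderBasis b f hf hQf) n =
      ∑ j ∈ Finset.range n, Q j := fun n => by
    ext z
    rw [SchauderBasis.proj_apply, _root_.sum_apply]
    exact Finset.sum_congr rfl fun j _ => (hQf j z).symm
  simp only [h]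
  exact hs g

/-- If all spaces of terms are lines, the predual of the space of series has a basis. -/
theorem WUCSeries.exists_schauderBasis {X : Type*} [NormedAddCommGroup X] [NormedSpace ℝ X]
    (hX : DualWUCNull X) {g : ℕ → StrongDual ℝ X} (hg : ∀ i, g i ≠ 0) :
    ∃ b : SchauderBasis ℝ (WUCSeries.Predual fun i => Submodule.span ℝ {g i}),
      b.IsOneUnconditional ∧ b.IsShrinkingBasis := by
  have hq := isBoundedlyCompleteUFDD_proj (G := fun i => Submodule.span ℝ {g i}) hX
    (fun _ => inferInstance)
  have hu : ∀ i, ∃ u : X, g i u = 1 := fun i => by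
    obtain ⟨x, hx⟩ := DFunLike.ne_iff.1 (hg i)
    exact ⟨(g i x)⁻¹ • x, by rw [map_smul, smul_eq_mul, inv_mul_cancel₀ hx]⟩
  choose u hu using hu
  let w : ∀ i, WUCSeries fun i => Submodule.span ℝ {g i} := fun i =>
    single i ⟨g i, Submodule.mem_span_singleton_self _⟩
  have hproj : ∀ i v, proj i v = coord i v (u i) • w i := fun i v => by
    rw [proj_eq_single, ← map_smul]
    congr 1
    obtain ⟨t, ht⟩ := Submodule.mem_span_singleton.1 (coord_mem i v)
    ext1
    change coord i v = coord i v (u i) • g i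
    rw [← ht, _root_.smul_apply, hu, smul_eq_mul, mul_one]
  -- `b i` is `v ↦ v_i (u i)`, the coefficient of the `i`-th term of `v`
  let b : ℕ → Predual fun i => Submodule.span ℝ {g i} := fun i =>
    .mk ((sumEval _ (u i)).comp (proj i)) (hq.toIsFDD.comp_mem_dualPart _ i)
  have hb : ∀ i v, (b i).val v = coord i v (u i) := fun i v => by
    change sumEval _ (u i) (proj i v) = _
    rw [sumEval_apply, tsum_eq_single i (fun j hj => by rw [coord_proj, if_neg hj]; rfl),
      coord_proj, if_pos rfl]
  let f : ℕ → StrongDual ℝ (Predual fun i => Submodule.span ℝ {g i}) := fun i =>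
    (NormedSpace.inclusionInDoubleDual ℝ _ (w i)).comp (DualPart.valL _).toContinuousLinearMap
  have hf : ∀ i j, f i (b j) = if i = j then 1 else 0 := fun i j => by
    change (b j).val (w i) = _
    rw [hb, coord_single]
    by_cases h : j = i
    · subst h; simp [hu]
    · rw [if_neg h, if_neg (Ne.symm h)]; rfl
  have hQf : ∀ j z, dualProj hq.toIsFDD j z = f j z • b j := fun j z => by
    ext v
    rw [coe_dualProj, ContinuousLinearMap.comp_apply, hproj, map_smul, smul_eq_mul, mul_comm]
    exact congrArg (z.val (w j) * ·) (hb j v).symm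
  exact ⟨hq.isOneUFDD_dualProj.toIsFDD.schauderBasis b f hf hQf,
    hq.isOneUFDD_dualProj.isOneUnconditional_schauderBasis hf hQf,
    IsShrinkingFDD.isShrinkingBasis_schauderBasis _ hq.isShrinkingFDD_dualProj hf hQf⟩

end Basis

/-! ### Subspaces of spaces with a shrinking unconditional basis -/

section Subspace

theorem dense_eventually_apply_eq_zero :
    Dense {h : lp (fun _ : ℕ => ℝ) 2 | ∀ᶠ j in atTop, h j = 0} := by
  intro h
  refine mem_closure_of_tendsto (lp.hasSum_single (p := 2) (by simp) h).tendsto_sum_nat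
    (Eventually.of_forall fun n => ?_)
  filter_upwards [eventually_ge_atTop n] with j hj
  rw [lp.coeFn_sum, Finset.sum_apply]
  refine Finset.sum_eq_zero fun i hi => ?_
  exact lp.single_apply_ne _ _ _ ((Finset.mem_range.1 hi).trans_le hj).ne'

/-- The functionals whose series form the predual are the nonzero members of finite nets of the
images of the dual ball of `Y` under the adjoints of the `A j`. A series `∑ f ∘ A_j` is then
approximated by one with terms in the nets. The space `ℓ₂` is added to `X` and one of its
coordinate functionals to each net, in order that there are infinitely many nonzero functionals
even if `X` is finite-dimensional. -/
theorem IsFinitaryExpansion.exists_schauderBasis {X Y : Type u} [NormedAddCommGroup X]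
    [NormedSpace ℝ X] [NormedAddCommGroup Y] [NormedSpace ℝ Y] (hX : DualWUCNull X) {c : ℝ}
    {J : X →ₗᵢ[ℝ] Y} {A : ℕ → X →L[ℝ] Y} (hA : IsFinitaryExpansion J.toContinuousLinearMap c A)
    {η : ℝ} (hη : 0 < η) (hη1 : η < 1) :
    ∃ (Z : Type u) (_ : NormedAddCommGroup Z) (_ : NormedSpace ℝ Z) (_ : CompleteSpace Z)
      (b : SchauderBasis ℝ Z) (W : Submodule ℝ Z),
      (IsReflexiveSpace X → IsReflexiveSpace Z) ∧ b.IsOneUnconditional ∧ b.IsShrinkingBasis ∧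
      banachMazurDist X W ≤ ENNReal.ofReal ((c + η) / (1 - η)) := by
  let r : ℕ → ℝ := fun n => η / 2 * (1 / 2) ^ n
  have hr : ∀ n, 0 < r n := fun n => by positivity
  have hnet : ∀ n, ∃ S : Set (StrongDual ℝ X), S.Finite ∧
      (∀ s ∈ S, ∃ f : StrongDual ℝ Y, f.comp (A n) = s) ∧
      ∀ f : StrongDual ℝ Y, ‖f‖ ≤ 1 → ∃ s ∈ S, ‖s - f.comp (A n)‖ ≤ r n := fun n => by
    obtain ⟨S, hS, hfin, hcov⟩ := Metric.finite_approx_of_totallyBounded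
      (totallyBounded_image_dual_ball (A n) (hA.finiteRank n)) (r n) (hr n)
    refine ⟨S, hfin, fun s hs => ?_, fun f hf => ?_⟩
    · obtain ⟨f, -, h⟩ := hS hs
      exact ⟨f, h⟩
    · have h1 := hcov (show f.comp (A n) ∈ _ from ⟨f, hf, rfl⟩)
      obtain ⟨s, hs, hfs⟩ := Set.mem_iUnion₂.1 h1
      rw [Metric.mem_ball, dist_comm, dist_eq_norm] at hfs
      exact ⟨s, hs, hfs.le⟩
  choose S hSfin hSA hScov using hnet
  let H := lp (fun _ : ℕ => ℝ) 2
  let S' : ℕ → Set (StrongDual ℝ (X × H)) := fun n =>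
    (fun s : StrongDual ℝ X => s.comp (ContinuousLinearMap.fst ℝ X H)) '' (S n \ {0}) ∪
      {(lp.evalCLM ℝ (fun _ : ℕ => ℝ) 2 n).comp (ContinuousLinearMap.snd ℝ X H)}
  obtain ⟨j, g, hg, hsurj, hinj, hj⟩ := exists_enumeration (S := S')
    (fun n => (((hSfin n).subset Set.sdiff_subset).image _).union (Set.finite_singleton _))
    (fun n => ⟨_, Or.inr rfl⟩)
  have hg0 : ∀ i, g i ≠ 0 := fun i h0 => by
    rcases hg i with ⟨s, ⟨-, hs⟩, h⟩ | h
    · refine hs (ContinuousLinearMap.ext fun x => ?_)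
      exact DFunLike.congr_fun (h.trans h0) ((x, 0) : X × H)
    · have h1 := DFunLike.congr_fun (h.symm.trans h0) ((0, lp.single 2 (j i) 1) : X × H)
      have h2 : (lp.single 2 (j i) (1 : ℝ) : H) (j i) = 0 := h1
      rw [lp.single_apply_self] at h2
      exact one_ne_zero h2
  have hX' : DualWUCNull (X × H) := hX.prod dualWUCNull_of_innerProductSpace
  have hG : ∀ i, FiniteDimensional ℝ (Submodule.span ℝ {g i}) := fun _ => inferInstance
  have hd : Dense {p : X × H | ∀ᶠ i in atTop, ∀ f ∈ Submodule.span ℝ {g i}, f p = 0} := by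
    refine (hA.dense.prod dense_eventually_apply_eq_zero).mono ?_
    rintro ⟨x, h⟩ ⟨hx, hh⟩
    filter_upwards [hj.eventually hx, hj.eventually hh] with i h1 h2 f hf
    obtain ⟨t, rfl⟩ := Submodule.mem_span_singleton.1 hf
    have h3 : g i (x, h) = 0 := by
      rcases hg i with ⟨s, ⟨hs, -⟩, h⟩ | h
      · obtain ⟨f, rfl⟩ := hSA _ s hs
        rw [← h]
        change f (A (j i) x) = 0
        rw [h1, map_zero]
      · rw [h]; exact h2
    rw [_root_.smul_apply, h3, smul_zero]
  have hq := WUCSeries.isBoundedlyCompleteUFDD_proj hX' hG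
  obtain ⟨b, hb1, hb2⟩ := WUCSeries.exists_schauderBasis hX' hg0
  let T : X →L[ℝ] WUCSeries.Predual fun i => Submodule.span ℝ {g i} :=
    (WUCSeries.embedding hX' hG hd).comp (ContinuousLinearMap.inl ℝ X H)
  have hT : ∀ x, ‖T x‖ ≤ ‖x‖ := fun x =>
    (WUCSeries.norm_embedding_le hX' hG hd _).trans (by simp [Prod.norm_def])
  have hc := hA.nonneg
  have hT' : ∀ x, (1 - η) * ‖x‖ ≤ (c + η) * ‖T x‖ := fun x => by
    obtain ⟨f, hf1, hfx⟩ := exists_dual_vector'' ℝ (J x)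
    replace hfx : f (J x) = ‖x‖ := by simpa using hfx
    choose s hs hsr using fun n => hScov n f hf1
    have hsn : ∀ n y, |s n y - f (A n y)| ≤ r n * ‖y‖ := fun n y =>
      (s n - f.comp (A n)).le_of_opNorm_le (hsr n) y
    have hfA : ∀ (F : Finset ℕ) y, ∑ n ∈ F, |f (A n y)| ≤ c * ‖y‖ := fun F y =>
      (hA.sum_abs_le f F y).trans (mul_le_mul_of_nonneg_right
        (mul_le_of_le_one_right hc hf1) (norm_nonneg _))
    have hrsum : ∀ F : Finset ℕ, ∑ n ∈ F, r n ≤ η := fun F =>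
      (Finset.sum_le_sum_of_subset_of_nonneg (fun n hn => Finset.mem_range.2
        (Nat.lt_succ_of_le (Finset.le_sup (f := id) hn))) fun n _ _ => (hr n).le).trans
        (sum_geometric_bound hη.le (F.sup id + 1))
    have hdiff : ∀ (F : Finset ℕ) y, ∑ n ∈ F, |s n y - f (A n y)| ≤ η * ‖y‖ := fun F y => by
      refine (Finset.sum_le_sum fun n _ => hsn n y).trans ?_
      rw [← Finset.sum_mul]
      exact mul_le_mul_of_nonneg_right (hrsum F) (norm_nonneg _)
    have hss : ∀ (F : Finset ℕ) y, ∑ n ∈ F, |s n y| ≤ (c + η) * ‖y‖ := fun F y => by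
      rw [add_mul]
      refine le_trans ?_ (add_le_add (hfA F y) (hdiff F y))
      rw [← Finset.sum_add_distrib]
      refine Finset.sum_le_sum fun n _ => ?_
      have := abs_add_le (f (A n y)) (s n y - f (A n y))
      rwa [add_sub_cancel] at this
    -- the positions at which the chosen net elements `s n` are enumerated
    let M : Set ℕ := {i | g i = (s (j i)).comp (ContinuousLinearMap.fst ℝ X H)}
    have hMinj : Set.InjOn j M := fun i hi k hk hik =>
      hinj i k hik (by rw [hi, hk, hik])
    classical
    let v : WUCSeries fun i => Submodule.span ℝ {g i} :=
      .mk (fun i => if i ∈ M then g i else 0) (fun i => by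
        split_ifs
        exacts [Submodule.mem_span_singleton_self _, Submodule.zero_mem _]) (c + η)
        (fun F p => by
          have h1 : ∀ i, |(if i ∈ M then g i else 0) p| = if i ∈ M then |s (j i) p.1| else 0 :=
            fun i => by
              split_ifs with hi
              · rw [show g i = _ from hi]; rfl
              · simp
          rw [Finset.sum_congr rfl fun i _ => h1 i, ← Finset.sum_filter,
            ← Finset.sum_image (f := fun n => |s n p.1|) (g := j) (fun i hi k hk hik =>
              hMinj (Finset.mem_filter.1 hi).2 (Finset.mem_filter.1 hk).2 hik)]
          exact (hss _ _).trans (mul_le_mul_of_nonneg_left (norm_fst_le p) (by positivity)))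
    have hv : ‖v‖ ≤ c + η := WUCSeries.norm_mk_le _ _ (by positivity) _
    have hTv : (T x).val v = ∑' n, s n x := by
      have h1 : (T x).val v = ∑' i, M.indicator (fun i => s (j i) x) i := by
        change WUCSeries.sumEval _ ((x, 0) : X × H) v = _
        rw [WUCSeries.sumEval_apply]
        refine tsum_congr fun i => ?_
        rw [WUCSeries.coord_mk, Set.indicator_apply]
        split_ifs with hi
        · rw [show g i = _ from hi]; rfl
        · rfl
      rw [h1, ← tsum_subtype M (fun i => s (j i) x)]
      refine Function.Injective.tsum_eq (g := fun i : M => j i) (f := fun n => s n x)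
        (fun i k hik => Subtype.ext (hMinj i.2 k.2 hik)) fun n hn => ?_
      have hn0 : s n ≠ 0 := fun h0 => hn (by simp [h0])
      obtain ⟨i, rfl, hi⟩ := hsurj n _ (Or.inl ⟨s n, ⟨hs n, hn0⟩, rfl⟩)
      exact ⟨⟨i, hi⟩, rfl⟩
    have hsumS : Summable fun n => s n x :=
      (summable_of_sum_le (fun _ => abs_nonneg _) fun F => hss F x).of_abs
    have hsumD : |∑' n, (s n x - f (A n x))| ≤ η * ‖x‖ := by
      have h := abs_tsum_mul_le (e := fun _ => 1) (by simp) fun F => hdiff F x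
      simpa using h
    have hsumA := hA.hasSum f x
    rw [hsumS.tsum_sub hsumA.summable, hsumA.tsum_eq] at hsumD
    have h2 : ∑' n, s n x ≤ ‖T x‖ * (c + η) := by
      rw [← hTv]
      refine (Real.le_norm_self _).trans ((ContinuousLinearMap.le_opNorm _ _).trans ?_)
      exact mul_le_mul_of_nonneg_left hv (norm_nonneg _)
    have h3 := (abs_le.1 hsumD).1
    change -(η * ‖x‖) ≤ ∑' n, s n x - f (J x) at h3
    rw [hfx] at h3
    linarith
  refine ⟨_, inferInstance, inferInstance, hq.completeSpace_dualPart, b, T.toLinearMap.range,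
    fun hr => ?_, hb1, hb2, ?_⟩
  · exact hq.isReflexiveSpace_dualPart (WUCSeries.mem_dualPart_of_isReflexiveSpace hX'
      (hr.prod isReflexiveSpace_of_innerProductSpace) hd)
  · have h1 : 0 < 1 - η := by linarith
    have h := banachMazurDist_range_le T zero_le_one (b := (c + η) / (1 - η)) (by positivity)
      (fun x => by simpa using hT x) (fun x => by
        rw [div_mul_eq_mul_div, le_div_iff₀ h1, mul_comm]
        exact hT' x)
    simpa using h

end Subspace

/-! ### The embedding theorem -/

theorem proposition3p4 (X : Type u) [NormedAddCommGroup X] [NormedSpace ℝ X] [CompleteSpace X]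
    [TopologicalSpace.SeparableSpace X]
    (hX : ¬ ContainsComplementedEllOne X)
    (hA : ∀ δ : ℝ, 0 < δ →
      ∃ (Y : Type u) (_ : NormedAddCommGroup Y) (_ : NormedSpace ℝ Y) (_ : CompleteSpace Y)
        (J : X →ₗᵢ[ℝ] Y) (A : ℕ → X →L[ℝ] Y), IsUnconditionalExpansion J δ A) :
    -- (i)
    (∀ δ : ℝ, 0 < δ →
      ∃ (Z : Type u) (_ : NormedAddCommGroup Z) (_ : NormedSpace ℝ Z) (_ : CompleteSpace Z)
        (b : SchauderBasis ℝ Z) (W : Submodule ℝ Z),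
        b.IsOneUnconditional ∧ b.IsShrinkingBasis ∧
        banachMazurDist X W < ENNReal.ofReal (1 + δ)) ∧
    -- (ii)
    (IsReflexiveSpace X → ∀ δ : ℝ, 0 < δ →
      ∃ (Z : Type u) (_ : NormedAddCommGroup Z) (_ : NormedSpace ℝ Z) (_ : CompleteSpace Z)
        (b : SchauderBasis ℝ Z) (W : Submodule ℝ Z),
        IsReflexiveSpace Z ∧ b.IsOneUnconditional ∧ b.IsShrinkingBasis ∧
        banachMazurDist X W < ENNReal.ofReal (1 + δ)) ∧
    -- (iii) and (iv)
    (((∀ δ : ℝ, 0 < δ → ∃ A : ℕ → X →L[ℝ] X,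
        IsUnconditionalExpansion (LinearIsometry.id : X →ₗᵢ[ℝ] X) δ A) ∨ HasUMAP X) →
      (∀ δ : ℝ, 0 < δ →
        ∃ (Z : Type u) (_ : NormedAddCommGroup Z) (_ : NormedSpace ℝ Z) (_ : CompleteSpace Z)
          (Q : ℕ → Z →L[ℝ] Z) (W : Submodule ℝ Z),
          IsOneUFDD Q ∧ IsShrinkingFDD Q ∧ W.IsComplementedWith (1 + δ) ∧
          banachMazurDist X W < ENNReal.ofReal (1 + δ)) ∧
      (IsReflexiveSpace X → ∀ δ : ℝ, 0 < δ →
        ∃ (Z : Type u) (_ : NormedAddCommGroup Z) (_ : NormedSpace ℝ Z) (_ : CompleteSpace Z)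
          (Q : ℕ → Z →L[ℝ] Z) (W : Submodule ℝ Z),
          IsReflexiveSpace Z ∧ IsOneUFDD Q ∧ IsShrinkingFDD Q ∧
          W.IsComplementedWith (1 + δ) ∧
          banachMazurDist X W < ENNReal.ofReal (1 + δ))) := by
  have hX' := dualWUCNull_of_not_containsComplementedEllOne hX
  have hbasis : ∀ δ : ℝ, 0 < δ →
      ∃ (Z : Type u) (_ : NormedAddCommGroup Z) (_ : NormedSpace ℝ Z) (_ : CompleteSpace Z)
        (b : SchauderBasis ℝ Z) (W : Submodule ℝ Z),
        (IsReflexiveSpace X → IsReflexiveSpace Z) ∧ b.IsOneUnconditional ∧ b.IsShrinkingBasis ∧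
        banachMazurDist X W < ENNReal.ofReal (1 + δ) := fun δ hδ => by
    -- `η` is chosen such that `(1 + 2 * η) / (1 - η) < 1 + δ`
    set η := δ / (4 + δ) with hη
    have hη0 : 0 < η := by positivity
    have hη1 : η * (4 + δ) = δ := div_mul_cancel₀ _ (by positivity)
    have hη2 : η < 1 := by rw [hη, div_lt_one (by positivity)]; linarith
    obtain ⟨Y, _, _, _, J, A, hJA⟩ := hA (η / 2) (by positivity)
    obtain ⟨A', hA'⟩ := hJA.exists_isFinitaryExpansion (η := η / 2) (by positivity)
    obtain ⟨Z, _, _, _, b, W, h1, h2, h3, h4⟩ := hA'.exists_schauderBasis hX' hη0 hη2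
    refine ⟨Z, inferInstance, inferInstance, inferInstance, b, W, h1, h2, h3, h4.trans_lt ?_⟩
    rw [ENNReal.ofReal_lt_ofReal_iff (by linarith), div_lt_iff₀ (by linarith)]
    nlinarith
  refine ⟨fun δ hδ => ?_, fun hr δ hδ => ?_, fun h => ?_⟩
  · obtain ⟨Z, i1, i2, i3, b, W, -, h⟩ := hbasis δ hδ
    exact ⟨Z, i1, i2, i3, b, W, h⟩
  · obtain ⟨Z, i1, i2, i3, b, W, hZ, h⟩ := hbasis δ hδ
    exact ⟨Z, i1, i2, i3, b, W, hZ hr, h⟩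
  have hfdd : ∀ δ : ℝ, 0 < δ →
      ∃ (Z : Type u) (_ : NormedAddCommGroup Z) (_ : NormedSpace ℝ Z) (_ : CompleteSpace Z)
        (Q : ℕ → Z →L[ℝ] Z) (W : Submodule ℝ Z),
        (IsReflexiveSpace X → IsReflexiveSpace Z) ∧ IsOneUFDD Q ∧ IsShrinkingFDD Q ∧
        W.IsComplementedWith (1 + δ) ∧ banachMazurDist X W < ENNReal.ofReal (1 + δ) :=
    fun δ hδ => by
      have hexp : ∃ A : ℕ → X →L[ℝ] X,
          IsFinitaryExpansion (ContinuousLinearMap.id ℝ X) (1 + δ / 2) A := by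
        rcases h with h | h
        · obtain ⟨A, hA⟩ := h (δ / 4) (by positivity)
          obtain ⟨A', hA'⟩ := hA.exists_isFinitaryExpansion (η := δ / 4) (by positivity)
          refine ⟨A', ?_⟩
          rw [show 1 + δ / 2 = 1 + δ / 4 + δ / 4 by ring]
          exact hA'
        · exact h.exists_isFinitaryExpansion (by positivity)
      obtain ⟨A, hA⟩ := hexp
      obtain ⟨Z, i1, i2, i3, Q, W, h1, h2, h3, ⟨P, hP, hPn⟩, h4⟩ := hA.exists_complemented hX'
      refine ⟨Z, i1, i2, i3, Q, W, h1, h2, h3, ⟨P, hP, hPn.trans (by linarith)⟩, h4.trans_lt ?_⟩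
      rw [ENNReal.ofReal_lt_ofReal_iff (by linarith)]
      linarith
  refine ⟨fun δ hδ => ?_, fun hr δ hδ => ?_⟩
  · obtain ⟨Z, i1, i2, i3, Q, W, -, h⟩ := hfdd δ hδ
    exact ⟨Z, i1, i2, i3, Q, W, h⟩
  · obtain ⟨Z, i1, i2, i3, Q, W, hZ, h⟩ := hfdd δ hδ
    exact ⟨Z, i1, i2, i3, Q, W, hZ hr, h⟩
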